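/- Let $n\ge 1$ and let $D\subset\mathbb C^n$ be a bounded domain (non-empty, open, connected). Let $\operatorname{Aut}(D)$ be the group of holomorphic automorphisms of $D$ with the compact-open topology, and for $f\in\operatorname{Aut}(D)$ let $\operatorname{Fix}(f)=\{z\in D: f(z)=z\}$. (1) The set $N\subset D^2$ of all pairs $(a,b)$ such that no $f\in\operatorname{Aut}(D)$ satisfies $\operatorname{Fix}(f)=\{a,b\}$ contains a set of full Lebesgue measure in $D^2$; that is, there is a measurable set $M\subset N$ such that $D^2\setminus M$ has measure $0$. (2) Let $a\in D$. The isotropy group $I_a=\{f\in\operatorname{Aut}(D): f(a)=a\}$ is a compact topological group. Let $\mu$ be its normalized Haar measure. Then $$\varphi(\zeta)=\int_{I_a} f'(a)^{-1}\bigl(f(\zeta)-a\bigr)\,d\mu(f),\qquad \zeta\in D,$$ is well defined (the integrand is integrable for every $\zeta\in D$) and is a holomorphic map $\varphi:D\to\mathbb C^n$ with $\varphi(a)=0$, $\varphi'(a)=\mathrm{id}$ and $\varphi\circ f=f'(a)\circ\varphi$ for all $f\in I_a$. Its zero set $Z=\{\zeta\in D:\varphi(\zeta)=0\}$ is a proper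 complex analytic subset of $D$ of complex dimension less than $n$. If $b\in D\setminus Z$, then for every $f\in\operatorname{Aut}(D)$ with $f(a)=a$ and $f(b)=b$, the fixed point set $\operatorname{Fix}(f)$ has complex dimension at least $1$. -/

import Mathlib

noncomputable section

namespace CartanFix

open MeasureTheory Set

/-- A self-homeomorphism of `D ⊆ ℂⁿ` viewed as a map `ℂⁿ → ℂⁿ` (identity outside `D`), so that
complex derivatives at points of the open set `D` can be taken. -/
def toMap {n : ℕ} {D : Set (Fin n → ℂ)} (f : D ≃ₜ D) (z : Fin n → ℂ) : Fin n → ℂ :=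
  open scoped Classical in if h : z ∈ D then (f ⟨z, h⟩ : Fin n → ℂ) else z

theorem toMap_coe {n : ℕ} {D : Set (Fin n → ℂ)} (f : D ≃ₜ D) (z : D) :
    toMap f z = f z := by
  simp [toMap]

theorem mapsTo_toMap {n : ℕ} {D : Set (Fin n → ℂ)} (f : D ≃ₜ D) : MapsTo (toMap f) D D := by
  intro z hz
  rw [toMap_coe f ⟨z, hz⟩]
  exact (f ⟨z, hz⟩).2

theorem toMap_one {n : ℕ} {D : Set (Fin n → ℂ)} : toMap (1 : D ≃ₜ D) = id := by
  funext z
  unfold toMap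
  split_ifs <;> rfl

theorem toMap_mul {n : ℕ} {D : Set (Fin n → ℂ)} (f g : D ≃ₜ D) (z : Fin n → ℂ) :
    toMap (f * g) z = toMap f (toMap g z) := by
  by_cases h : z ∈ D
  · rw [toMap_coe (f * g) ⟨z, h⟩, toMap_coe g ⟨z, h⟩, toMap_coe f (g ⟨z, h⟩)]
    rfl
  · simp [toMap, h]

/-- The group `Aut(D)` of holomorphic automorphisms of `D ⊆ ℂⁿ`: the homeomorphisms of `D` onto
itself that are holomorphic together with their inverse. -/
def holAut {n : ℕ} (D : Set (Fin n → ℂ)) : Subgroup (D ≃ₜ D) where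
  carrier := {f | DifferentiableOn ℂ (toMap f) D ∧ DifferentiableOn ℂ (toMap f⁻¹) D}
  mul_mem' := by
    rintro f g ⟨hf, hf'⟩ ⟨hg, hg'⟩
    refine ⟨(hf.comp hg (mapsTo_toMap g)).congr fun z _ => toMap_mul f g z, ?_⟩
    rw [mul_inv_rev]
    exact (hg'.comp hf' (mapsTo_toMap f⁻¹)).congr fun z _ => toMap_mul g⁻¹ f⁻¹ z
  one_mem' := by
    have h : DifferentiableOn ℂ (toMap (1 : D ≃ₜ D)) D := by
      rw [toMap_one]
      exact differentiableOn_id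
    exact ⟨h, by rw [inv_one]; exact h⟩
  inv_mem' := by
    rintro f ⟨hf, hf'⟩
    exact ⟨hf', by rw [inv_inv]; exact hf⟩

/-- The isotropy group `I_a(D)`: the holomorphic automorphisms of `D` fixing `a`. -/
def isotropy {n : ℕ} (D : Set (Fin n → ℂ)) (a : D) : Subgroup (D ≃ₜ D) where
  carrier := {f | f ∈ holAut D ∧ f a = a}
  mul_mem' := by
    rintro f g ⟨hf, hfa⟩ ⟨hg, hga⟩
    refine ⟨mul_mem hf hg, ?_⟩
    change f (g a) = a
    rw [hga, hfa]
  one_mem' := ⟨one_mem _, rfl⟩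
  inv_mem' := by
    rintro f ⟨hf, hfa⟩
    refine ⟨inv_mem hf, ?_⟩
    change f.symm a = a
    rw [Homeomorph.symm_apply_eq, hfa]

/-- The compact-open topology on the self-homeomorphisms of `D`; the groups of automorphisms
carry the subspace topology. -/
instance instTopologicalSpaceHomeomorph {n : ℕ} (D : Set (Fin n → ℂ)) :
    TopologicalSpace (D ≃ₜ D) :=
  TopologicalSpace.induced (fun f : D ≃ₜ D => (f : C(D, D))) inferInstance

instance instMeasurableSpaceIsotropy {n : ℕ} (D : Set (Fin n → ℂ)) (a : D) :
    MeasurableSpace (isotropy D a) :=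
  borel _

instance instBorelSpaceIsotropy {n : ℕ} (D : Set (Fin n → ℂ)) (a : D) :
    BorelSpace (isotropy D a) :=
  ⟨rfl⟩

/-- The integrand `f'(a)⁻¹ (f(ζ) - a)` of the Cartan map. -/
def cartanIntegrand {n : ℕ} {D : Set (Fin n → ℂ)} (a : D) (ζ : Fin n → ℂ)
    (f : isotropy D a) : Fin n → ℂ :=
  (fderiv ℂ (toMap f.1) a).inverse (toMap f.1 ζ - a)

/-- Cartan's linearizing map `φ(ζ) = ∫ f'(a)⁻¹ (f(ζ) - a) dμ(f)`, the integral being over the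
isotropy group `I_a(D)`. -/
def cartanMap {n : ℕ} {D : Set (Fin n → ℂ)} (a : D) (μ : Measure (isotropy D a))
    (ζ : Fin n → ℂ) : Fin n → ℂ :=
  ∫ f, cartanIntegrand a ζ f ∂μ

/-- The zero set in `D` of the Cartan map at `a`. -/
def cartanZeroSet {n : ℕ} {D : Set (Fin n → ℂ)} (a : D) (μ : Measure (isotropy D a)) :
    Set (Fin n → ℂ) :=
  {ζ | ζ ∈ D ∧ cartanMap a μ ζ = 0}

/-- `Z` is a complex analytic subset of the open set `D ⊆ ℂⁿ`: near every point of `D` it is the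
common zero set of finitely many holomorphic functions. -/
def IsAnalyticSubset {n : ℕ} (D Z : Set (Fin n → ℂ)) : Prop :=
  Z ⊆ D ∧ ∀ p ∈ D, ∃ U : Set (Fin n → ℂ), IsOpen U ∧ p ∈ U ∧ U ⊆ D ∧
    ∃ (m : ℕ) (g : Fin m → (Fin n → ℂ) → ℂ), (∀ i, DifferentiableOn ℂ (g i) U) ∧
      Z ∩ U = {z | z ∈ U ∧ ∀ i, g i z = 0}

/-- `A ⊆ ℂⁿ` contains a complex submanifold of dimension `k`, given by a holomorphic
parametrization: an injective immersion of a nonempty open subset of `ℂᵏ` (which is an embedding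
after shrinking this open set). -/
def ContainsSubmanifold {n : ℕ} (k : ℕ) (A : Set (Fin n → ℂ)) : Prop :=
  ∃ (U : Set (Fin k → ℂ)) (g : (Fin k → ℂ) → (Fin n → ℂ)), IsOpen U ∧ U.Nonempty ∧
    DifferentiableOn ℂ g U ∧ InjOn g U ∧ (∀ u ∈ U, Function.Injective (fderiv ℂ g u)) ∧
    MapsTo g U A

/-- The complex dimension of an analytic set: the largest dimension of a complex submanifold
contained in it (equivalently, of its manifold of regular points); `⊥` for the empty set. -/
def complexDim {n : ℕ} (A : Set (Fin n → ℂ)) : WithBot ℕ∞ :=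
  ⨆ (k : ℕ) (_ : ContainsSubmanifold k A), ((k : ℕ∞) : WithBot ℕ∞)

/-- The fixed point set of a self-map of `D`, as a subset of `ℂⁿ`. -/
def fixSet {n : ℕ} {D : Set (Fin n → ℂ)} (f : D ≃ₜ D) : Set (Fin n → ℂ) :=
  {z | z ∈ D ∧ toMap f z = z}

/-- The pairs `(a, b) ∈ D²` such that `{a, b}` is not the fixed point set of any holomorphic
automorphism of `D`. -/
def nonFixedPairs {n : ℕ} (D : Set (Fin n → ℂ)) : Set ((Fin n → ℂ) × (Fin n → ℂ)) :=
  {p | p ∈ D ×ˢ D ∧ ¬ ∃ f ∈ holAut D, fixSet f = {p.1, p.2}}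

end CartanFix

end

noncomputable section

namespace CartanFix

open MeasureTheory Set Metric Filter Topology

/-! ### Cauchy estimates and locally uniform limits of holomorphic maps. -/

section ComplexAnalysis

/-! The heart is Cartan's linearization. Since `D` is bounded, Cauchy estimates make `Aut(D)`
equicontinuous, and Arzelà–Ascoli shows that the isotropy group at `a` is compact. Averaging
`f'(a)⁻¹(f - a)` over it yields a holomorphic `φ`, tangent to the identity at `a`, with `φ ∘ f =
f'(a) ∘ φ` (`cartanMap_toMap`). If `f` fixes both `a` and `b`, then `v = φ(b)` is fixed by `f'(a)`.
When `v ≠ 0`, the local inverse of `φ` at `a` carries the disc of points `t • v` to a curve of fixed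
points of `f` (`exists_curve_of_fixed_points`), so the fixed point set has dimension at least one.

Hence a pair `(a, b)` can be a fixed point set only if `b` lies in the zero set of `φ`. This set is
null for each `a`, because `φ` does not vanish identically (`measure_zeros_eq_zero`).

To pass to `D²` by Fubini, a measurable exceptional set is needed, and the dependence of `φ` on `a`
is not studied. Instead, the bad pairs are covered by countably many closed sets
(`isolatedFixedPairs`), in which the automorphism ranges over a compact set and the isolation of `a`
among its fixed points is quantified. The curve argument applies to all of these sets, so their
slices over each `a` are still null. -/

theorem exists_ball_tendstoUniformlyOn {E F ι : Type*} [NormedAddCommGroup E] [NormedAddCommGroup F]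
    [ProperSpace E] {l : Filter ι} {G : ι → E → F} {f : E → F} {U : Set E} (hU : IsOpen U)
    (h : TendstoLocallyUniformlyOn G f l U)
    {x : E} (hx : x ∈ U) :
    ∃ r > 0, ball x (2 * r) ⊆ U ∧ TendstoUniformlyOn G f l (ball x (2 * r)) := by
  obtain ⟨s, hs, hsU⟩ := nhds_basis_closedBall.mem_iff.1 (hU.mem_nhds hx)
  refine ⟨s / 2, by positivity, ?_⟩
  rw [mul_div_cancel₀ s two_ne_zero]
  exact ⟨ball_subset_closedBall.trans hsU,
    ((tendstoLocallyUniformlyOn_iff_forall_isCompact hU).1 h _ hsU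
      (isCompact_closedBall x s)).mono ball_subset_closedBall⟩

variable {E F : Type*} [NormedAddCommGroup E] [NormedSpace ℂ E] [NormedAddCommGroup F]
  [NormedSpace ℂ F]

/-- Cauchy's estimate for the Fréchet derivative of a bounded holomorphic map on a ball. -/
theorem norm_fderiv_le_of_norm_le {f : E → F} {c : E} {r M : ℝ} (hr : 0 < r)
    (hd : DifferentiableOn ℂ f (ball c r)) (hM : ∀ z ∈ ball c r, ‖f z‖ ≤ M) :
    ‖fderiv ℂ f c‖ ≤ 2 * M / r := by
  refine Complex.norm_fderiv_le_div_of_mapsTo_ball hd (fun z hz => ?_) hr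
  rw [mem_closedBall, dist_eq_norm]
  linarith [norm_sub_le (f z) (f c), hM z hz, hM c (mem_ball_self hr)]

/-- A bounded holomorphic map on a ball is Lipschitz about the centre. -/
theorem norm_sub_le_of_norm_le {f : E → F} {c z : E} {r M : ℝ} (hr : 0 < r)
    (hd : DifferentiableOn ℂ f (ball c r)) (hM : ∀ z ∈ ball c r, ‖f z‖ ≤ M)
    (hz : z ∈ ball c r) : ‖f z - f c‖ ≤ 2 * M / r * ‖z - c‖ := by
  rw [← dist_eq_norm, ← dist_eq_norm]
  refine Complex.dist_le_div_mul_dist_of_mapsTo_ball hd (fun w hw => ?_) hz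
  rw [mem_closedBall, dist_eq_norm]
  linarith [norm_sub_le (f w) (f c), hM w hw, hM c (mem_ball_self hr)]

/-- The difference `f(· + h) - f` is of size `O(‖h‖)` by the Lipschitz bound, and the Cauchy
estimate turns this into a bound on the difference of derivatives. -/
theorem continuousOn_fderiv_of_differentiableOn {f : E → F} {U : Set E} (hU : IsOpen U)
    (hf : DifferentiableOn ℂ f U) : ContinuousOn (fderiv ℂ f) U := by
  intro x hx
  refine ContinuousAt.continuousWithinAt ?_
  obtain ⟨s, hs, hsU⟩ : ∃ s > 0, ball x s ⊆ {z | z ∈ U ∧ ‖f z‖ ≤ ‖f x‖ + 1} := by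
    refine Metric.mem_nhds_iff.1 ?_
    have h1 : ∀ᶠ z in 𝓝 x, ‖f z‖ < ‖f x‖ + 1 :=
      ((hf.continuousOn.continuousAt (hU.mem_nhds hx)).norm).eventually_lt continuousAt_const
        (by simp)
    filter_upwards [hU.mem_nhds hx, h1] with z hz hz' using ⟨hz, hz'.le⟩
  set M := ‖f x‖ + 1
  -- The radius `s / 3` leaves room in `ball x s` for both the shift by `y - x` and the ball on
  -- which the Lipschitz estimate is applied.
  have hM : 0 ≤ M := by positivity
  have key : ∀ y ∈ ball x (s / 3), ‖fderiv ℂ f y - fderiv ℂ f x‖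
      ≤ 2 * (2 * M / (s / 3) * ‖y - x‖) / (s / 3) := by
    intro y hy
    rw [mem_ball, dist_eq_norm] at hy
    have hin : ∀ z ∈ ball x (s / 3), z + (y - x) ∈ ball x s := by
      intro z hz
      rw [mem_ball, dist_eq_norm] at hz ⊢
      calc ‖z + (y - x) - x‖ = ‖(z - x) + (y - x)‖ := by congr 1; abel
        _ ≤ _ := norm_add_le _ _
        _ < s := by linarith
    have hd1 : DifferentiableOn ℂ (fun z => f (z + (y - x))) (ball x (s / 3)) :=
      (hf.mono fun z hz => (hsU hz).1).comp (differentiableOn_id.add_const _) hin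
    have hd2 : DifferentiableOn ℂ f (ball x (s / 3)) :=
      hf.mono fun z hz => (hsU (ball_subset_ball (by linarith) hz)).1
    have h := norm_fderiv_le_of_norm_le (f := (fun z => f (z + (y - x))) - f) (c := x)
      (r := s / 3) (M := 2 * M / (s / 3) * ‖y - x‖) (by linarith) (hd1.sub hd2) ?_
    · rw [fderiv_sub (hd1.differentiableAt (ball_mem_nhds _ (by linarith)))
        (hd2.differentiableAt (ball_mem_nhds _ (by linarith))), fderiv_comp_add_right] at h
      simpa using h
    · intro z hz
      rw [mem_ball, dist_eq_norm] at hz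
      have hsub : ball z (s / 3) ⊆ ball x s := by
        intro w hw
        rw [mem_ball, dist_eq_norm] at hw ⊢
        calc ‖w - x‖ = ‖(w - z) + (z - x)‖ := by congr 1; abel
          _ ≤ _ := norm_add_le _ _
          _ < s := by linarith
      have := norm_sub_le_of_norm_le (f := f) (c := z) (z := z + (y - x)) (r := s / 3) (M := M)
        (by linarith) (hf.mono fun w hw => (hsU (hsub hw)).1) (fun w hw => (hsU (hsub hw)).2)
        (by rw [mem_ball, dist_eq_norm]; simpa using hy)
      simpa using this
  rw [ContinuousAt, tendsto_iff_norm_sub_tendsto_zero]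
  have hlim : Tendsto (fun y => 2 * (2 * M / (s / 3) * ‖y - x‖) / (s / 3)) (𝓝 x) (𝓝 0) := by
    have : Continuous fun y : E => 2 * (2 * M / (s / 3) * ‖y - x‖) / (s / 3) := by fun_prop
    simpa using this.tendsto x
  refine squeeze_zero' (Eventually.of_forall fun _ => norm_nonneg _) ?_ hlim
  filter_upwards [ball_mem_nhds x (by linarith : 0 < s / 3)] with y hy using key y hy

theorem contDiffOn_one_of_differentiableOn {f : E → F} {U : Set E} (hU : IsOpen U)
    (hf : DifferentiableOn ℂ f U) : ContDiffOn ℂ 1 f U :=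
  (contDiffOn_succ_iff_fderiv_of_isOpen (n := 0) hU).2 ⟨hf, by simp,
    contDiffOn_zero.2 (continuousOn_fderiv_of_differentiableOn hU hf)⟩

theorem hasStrictFDerivAt_of_differentiableOn {f : E → F} {U : Set E} (hU : IsOpen U)
    (hf : DifferentiableOn ℂ f U) {x : E} (hx : x ∈ U) :
    HasStrictFDerivAt f (fderiv ℂ f x) x :=
  ((contDiffOn_one_of_differentiableOn hU hf).contDiffAt (hU.mem_nhds hx)).hasStrictFDerivAt
    one_ne_zero

section LocallyUniformLimit

variable [ProperSpace E] {ι : Type*} {l : Filter ι} [l.NeBot] {G : ι → E → F} {f : E → F}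
  {U : Set E}

/-- Locally uniform limits of holomorphic maps are holomorphic. -/
theorem differentiableOn_of_tendstoLocallyUniformlyOn [CompleteSpace F] (hU : IsOpen U)
    (h : TendstoLocallyUniformlyOn G f l U) (hG : ∀ᶠ i in l, DifferentiableOn ℂ (G i) U) :
    DifferentiableOn ℂ f U := by
  intro x hx
  obtain ⟨r, hr, hrU, hunif⟩ := exists_ball_tendstoUniformlyOn hU h hx
  have hsub : ∀ y ∈ ball x r, ball y r ⊆ ball x (2 * r) := fun y hy =>
    ball_subset_ball' (by rw [mem_ball] at hy; linarith)
  -- The Cauchy estimate on differences makes the derivatives uniformly Cauchy; `ε * r / 4` becomes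
  -- `ε / 2` after the factor `2 / r`.
  have hC : UniformCauchySeqOn (fun i => fderiv ℂ (G i)) l (ball x r) := by
    intro u hu
    obtain ⟨ε, hε, hεu⟩ := Metric.mem_uniformity_dist.1 hu
    have hG2 : ∀ᶠ m : ι × ι in l ×ˢ l,
        DifferentiableOn ℂ (G m.1) U ∧ DifferentiableOn ℂ (G m.2) U :=
      (tendsto_fst.eventually hG).and (tendsto_snd.eventually hG)
    filter_upwards [hunif.uniformCauchySeqOn _
      (Metric.dist_mem_uniformity (show 0 < ε * r / 4 by positivity)), hG2] with m hm hGm y hy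
    refine hεu ?_
    have hsy := (hsub y hy).trans hrU
    have h := norm_fderiv_le_of_norm_le (f := G m.1 - G m.2) (c := y) (M := ε * r / 4) hr
      ((hGm.1.mono hsy).sub (hGm.2.mono hsy)) fun z hz => by
        have : dist (G m.1 z) (G m.2 z) < ε * r / 4 := hm z (hsub y hy hz)
        rw [dist_eq_norm] at this
        exact this.le
    rw [fderiv_sub ((hGm.1.mono hsy).differentiableAt (ball_mem_nhds _ hr))
      ((hGm.2.mono hsy).differentiableAt (ball_mem_nhds _ hr))] at h
    rw [dist_eq_norm]
    refine h.trans_lt ?_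
    field_simp
    linarith
  have hlim : ∀ y ∈ ball x r, ∃ g, Tendsto (fun i => fderiv ℂ (G i) y) l (𝓝 g) := fun y hy =>
    cauchy_map_iff_exists_tendsto.1 (hC.cauchy_map hy)
  choose! g' hg' using hlim
  have hu' := hC.tendstoUniformlyOn_of_tendsto hg'
  have hd : HasFDerivAt f (g' x) x := by
    refine hasFDerivAt_of_tendstoUniformlyOnFilter
      (f' := fun i => fderiv ℂ (G i)) (f := G) (l := l) (g' := g') ?_ ?_ ?_
    · exact (tendstoUniformlyOn_iff_tendstoUniformlyOnFilter.1 hu').mono_right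
        (le_principal_iff.2 (ball_mem_nhds _ hr))
    · filter_upwards [prod_mem_prod hG (ball_mem_nhds x hr)] with p hp
      have hpU : p.2 ∈ U := hrU (hsub _ hp.2 (mem_ball_self hr))
      exact (DifferentiableOn.differentiableAt hp.1 (hU.mem_nhds hpU)).hasFDerivAt
    · filter_upwards [ball_mem_nhds x hr] with y hy
      exact hunif.tendsto_at (hsub y hy (mem_ball_self hr))
  exact hd.differentiableAt.differentiableWithinAt

theorem tendsto_fderiv_of_tendstoLocallyUniformlyOn [CompleteSpace F] (hU : IsOpen U)
    (h : TendstoLocallyUniformlyOn G f l U) (hG : ∀ᶠ i in l, DifferentiableOn ℂ (G i) U)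
    {x : E} (hx : x ∈ U) :
    Tendsto (fun i => fderiv ℂ (G i) x) l (𝓝 (fderiv ℂ f x)) := by
  have hf := differentiableOn_of_tendstoLocallyUniformlyOn hU h hG
  obtain ⟨r, hr, hrU, hunif⟩ := exists_ball_tendstoUniformlyOn hU h hx
  have hsub : ball x r ⊆ ball x (2 * r) := ball_subset_ball (by linarith)
  rw [Metric.tendsto_nhds]
  intro ε hε
  filter_upwards [Metric.tendstoUniformlyOn_iff.1 hunif (ε * r / 4) (by positivity), hG]
    with i hi hGi
  have hd1 := hGi.mono (hsub.trans hrU)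
  have hd2 := hf.mono (hsub.trans hrU)
  have h := norm_fderiv_le_of_norm_le (f := G i - f) (c := x) (M := ε * r / 4) hr (hd1.sub hd2)
    fun z hz => by
      have := (hi z (hsub hz)).le
      rwa [dist_comm, dist_eq_norm] at this
  rw [fderiv_sub (hd1.differentiableAt (ball_mem_nhds _ hr))
    (hd2.differentiableAt (ball_mem_nhds _ hr))] at h
  rw [dist_eq_norm]
  refine h.trans_lt ?_
  field_simp
  linarith

end LocallyUniformLimit

/-! ### The identity theorem and the measure of zero sets. -/

section IdentityTheorem

variable [CompleteSpace F] {f : E → F} {w : E} {r : ℝ}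

theorem analyticOnNhd_comp_line (hf : DifferentiableOn ℂ f (ball w r)) (x : E) :
    AnalyticOnNhd ℂ (fun t : ℂ => f (w + t • x)) ((fun t : ℂ => w + t • x) ⁻¹' ball w r) := by
  have hc : Differentiable ℂ fun t : ℂ => w + t • x :=
    (differentiable_id.smul_const x).const_add w
  exact (hf.comp hc.differentiableOn fun t ht => ht).analyticOnNhd
    (isOpen_ball.preimage hc.continuous)

theorem isPreconnected_preimage_line_ball (w x : E) (r : ℝ) :
    IsPreconnected ((fun t : ℂ => w + t • x) ⁻¹' ball w r) := by
  refine Convex.isPreconnected ?_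
  have h : ((fun t : ℂ => w + t • x) ⁻¹' ball w r)
      = ((LinearMap.id : ℂ →ₗ[ℂ] ℂ).smulRight x).restrictScalars ℝ ⁻¹' ball 0 r := by
    ext t
    simp [dist_eq_norm]
  rw [h]
  exact (convex_ball (0 : E) r).linear_preimage _

theorem eqOn_zero_ball_of_eventuallyEq_zero (hf : DifferentiableOn ℂ f (ball w r))
    (h0 : f =ᶠ[𝓝 w] 0) : EqOn f 0 (ball w r) := by
  intro x hx
  have hr : 0 < r := nonempty_ball.1 ⟨x, hx⟩
  have hc : Continuous fun t : ℂ => w + t • (x - w) := by fun_prop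
  have h := (analyticOnNhd_comp_line hf (x - w)).eqOn_zero_of_preconnected_of_eventuallyEq_zero
    (isPreconnected_preimage_line_ball w (x - w) r) (z₀ := 0) (by simpa using hr)
    (by
      have : Tendsto (fun t : ℂ => w + t • (x - w)) (𝓝 0) (𝓝 w) := by simpa using hc.tendsto 0
      exact this.eventually h0)
  simpa using h (x := 1) (by simpa using hx)

/-- The identity theorem for holomorphic maps on a domain of a complex normed space. -/
theorem eqOn_zero_of_preconnected_of_eventuallyEq_zero {D : Set E} (hD : IsOpen D)
    (hDc : IsPreconnected D) (hf : DifferentiableOn ℂ f D) {a : E} (ha : a ∈ D)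
    (h0 : f =ᶠ[𝓝 a] 0) : EqOn f 0 D := by
  -- The set of points near which `f` vanishes is open; the ball version, proved on complex lines,
  -- makes it relatively closed in `D`.
  have hsub : D ⊆ {z | f =ᶠ[𝓝 z] 0} := by
    refine hDc.subset_of_closure_inter_subset isOpen_setOfPred_eventually_nhds ⟨a, ha, h0⟩ ?_
    rintro p ⟨hp, hpD⟩
    obtain ⟨s, hs, hsD⟩ := Metric.isOpen_iff.1 hD p hpD
    obtain ⟨w, hw, hpw⟩ := Metric.mem_closure_iff.1 hp (s / 2) (by positivity)
    have hwD : ball w (s / 2) ⊆ D :=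
      (ball_subset_ball' (by rw [dist_comm]; linarith)).trans hsD
    have h := eqOn_zero_ball_of_eventuallyEq_zero (hf.mono hwD) hw
    exact mem_of_superset (isOpen_ball.mem_nhds hpw) h
  exact fun z hz => (hsub hz).self_of_nhds

variable [FiniteDimensional ℂ E] [MeasurableSpace E] [BorelSpace E] (μ : Measure E)
  [μ.IsAddHaarMeasure]

/-- Each ray from `w` meets the zeros in a discrete set, since `f` is analytic along it and nonzero
at `w`. Fubini in direction and scale then gives a scale `s` whose slice is null, and dilating that
slice covers the zeros in the half ball. -/
theorem measure_zeros_inter_ball_eq_zero (hf : DifferentiableOn ℂ f (ball w r)) (hw : f w ≠ 0) :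
    μ ({z | f z = 0} ∩ ball w (r / 2)) = 0 := by
  rcases le_or_gt r 0 with hr | hr
  · rw [ball_eq_empty.2 (by linarith), inter_empty, measure_empty]
  set Z : Set E := {z | z ∈ ball w r ∧ f z = 0}
  have hZ : MeasurableSet Z := by
    have h : IsOpen (ball w r ∩ f ⁻¹' {0}ᶜ) :=
      hf.continuousOn.isOpen_inter_preimage isOpen_ball isOpen_compl_singleton
    have : Z = ball w r \ (ball w r ∩ f ⁻¹' {0}ᶜ) := by
      ext z
      simp only [Z, mem_ofPred_eq, Set.mem_sdiff, mem_inter_iff, mem_preimage, mem_compl_iff,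
        mem_singleton_iff]
      tauto
    rw [this]
    exact measurableSet_ball.diff h.measurableSet
  -- Scales below `2` keep `w + s • x` inside `ball w r`; scales above `1` ensure that `s⁻¹ • (z -
  -- w)` stays in the half ball.
  set P : Set (E × ℝ) := {p | p.1 ∈ ball (0 : E) (r / 2) ∧ p.2 ∈ Ioo (1 : ℝ) 2 ∧
    w + p.2 • p.1 ∈ Z}
  have hP : MeasurableSet P := by
    refine (measurableSet_ball.preimage measurable_fst).inter
      ((measurableSet_Ioo.preimage measurable_snd).inter (hZ.preimage ?_))
    exact Continuous.measurable (by fun_prop)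
  have hP0 : (μ.prod volume) P = 0 := by
    rw [Measure.measure_prod_null hP]
    refine Eventually.of_forall fun x => ?_
    by_cases hx : x ∈ ball (0 : E) (r / 2)
    swap
    · have : Prod.mk x ⁻¹' P = ∅ := by
        ext s
        simp only [P, mem_preimage, mem_ofPred_eq, hx, false_and, mem_empty_iff_false]
      simp [this]
    have hx' : ‖x‖ < r / 2 := by simpa using hx
    set k : ℝ → F := fun s => f (w + (s : ℂ) • x)
    have hin : ∀ s ∈ Ioo (-2 : ℝ) 2, (s : ℂ) ∈ (fun t : ℂ => w + t • x) ⁻¹' ball w r := by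
      intro s hs
      have : |s| ≤ 2 := (abs_lt.2 hs).le
      simp only [mem_preimage, mem_ball, dist_eq_norm, add_sub_cancel_left, norm_smul,
        Complex.norm_real, Real.norm_eq_abs]
      nlinarith [norm_nonneg x]
    -- The interval is enlarged to contain `0`, where `k` takes the nonzero value `f w`.
    have hk : AnalyticOnNhd ℝ k (Ioo (-2 : ℝ) 2) := fun s hs =>
      AnalyticAt.comp (f := fun s : ℝ => (s : ℂ))
        ((analyticOnNhd_comp_line hf x (s : ℂ) (hin s hs)).restrictScalars)
        (Complex.ofRealCLM.analyticAt s)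
    have hcod := hk.preimage_zero_mem_codiscreteWithin (x := 0) (by simpa [k] using hw)
      (by norm_num) (isConnected_Ioo (by norm_num))
    have hae := ae_restrict_le_codiscreteWithin (μ := volume) measurableSet_Ioo hcod
    rw [mem_ae_iff, Measure.restrict_apply'
      (measurableSet_Ioo)] at hae
    refine measure_mono_null ?_ hae
    rintro s ⟨-, hs, -, hs0⟩
    refine ⟨?_, by linarith [hs.1], hs.2⟩
    simpa [k] using hs0
  rw [← Measure.prod_swap, Measure.map_apply measurable_swap hP,
    Measure.measure_prod_null (hP.preimage measurable_swap)] at hP0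
  obtain ⟨s, hs, hs0⟩ : ∃ s ∈ Ioo (1 : ℝ) 2, μ (Prod.mk s ⁻¹' (Prod.swap ⁻¹' P)) = 0 := by
    by_contra! hcon
    have : volume (Ioo (1 : ℝ) 2) = 0 := measure_mono_null (fun s hs h => hcon s hs h) hP0
    norm_num at this
  have hspos : 0 < s := by linarith [hs.1]
  have hsub : {z | f z = 0} ∩ ball w (r / 2) ⊆
      (fun z => z + -w) ⁻¹' ((fun z => s⁻¹ • z) ⁻¹' (Prod.mk s ⁻¹' (Prod.swap ⁻¹' P))) := by
    rintro z ⟨hz0, hz⟩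
    have hz0 : f z = 0 := hz0
    rw [mem_ball, dist_eq_norm] at hz
    refine ⟨?_, hs, ?_⟩
    · simp only [Prod.fst_swap, mem_ball, dist_zero_right, norm_smul, norm_inv,
        Real.norm_eq_abs, abs_of_pos hspos, ← sub_eq_add_neg]
      have : s⁻¹ ≤ 1 := inv_le_one_of_one_le₀ hs.1.le
      nlinarith [norm_nonneg (z - w)]
    · simp only [Prod.fst_swap, Prod.snd_swap]
      rw [smul_inv_smul₀ hspos.ne']
      have : w + (z + -w) = z := by abel
      rw [this]
      exact ⟨by rw [mem_ball, dist_eq_norm]; linarith, hz0⟩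
  refine measure_mono_null hsub ?_
  rw [measure_preimage_add_right, Measure.addHaar_preimage_smul μ (inv_ne_zero hspos.ne'), hs0,
    mul_zero]

/-- The zero set of a holomorphic map that does not vanish identically on a domain is a null
set. -/
theorem measure_zeros_eq_zero {D : Set E} (hD : IsOpen D) (hDc : IsPreconnected D)
    (hf : DifferentiableOn ℂ f D) (h0 : ∃ z ∈ D, f z ≠ 0) : μ {z | z ∈ D ∧ f z = 0} = 0 := by
  have : ProperSpace E := FiniteDimensional.proper ℂ E
  refine measure_null_of_locally_null _ fun p hp => ?_
  obtain ⟨s, hs, hsD⟩ := Metric.isOpen_iff.1 hD p hp.1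
  have hne : ∃ w ∈ ball p (s / 4), f w ≠ 0 := by
    by_contra! hcon
    obtain ⟨z, hz, hfz⟩ := h0
    exact hfz (eqOn_zero_of_preconnected_of_eventuallyEq_zero hD hDc hf hp.1
      (mem_of_superset (ball_mem_nhds p (by positivity)) hcon) hz)
  obtain ⟨w, hw, hfw⟩ := hne
  rw [mem_ball] at hw
  have hwD : ball w (s / 2) ⊆ D := (ball_subset_ball' (by linarith)).trans hsD
  refine ⟨_, ?_, measure_zeros_inter_ball_eq_zero μ (hf.mono hwD) hfw⟩
  refine inter_mem (mem_of_superset self_mem_nhdsWithin fun z hz => hz.2)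
    (mem_nhdsWithin_of_mem_nhds (isOpen_ball.mem_nhds ?_))
  rw [mem_ball, dist_comm]
  linarith

end IdentityTheorem

/-! ### Fixed-point curves from a linearization. -/

section LocalInverse

variable [CompleteSpace E]

/-- A holomorphic map `φ` that linearizes `f` near its fixed point `a` yields a holomorphic curve
of fixed points of `f` for each eigenvector of the linear part with eigenvalue `1`. -/
theorem exists_curve_of_fixed_points {D : Set E} (hD : IsOpen D) {φ f : E → E} {a v : E}
    (ha : a ∈ D) (hφ : DifferentiableOn ℂ φ D) (hφa : φ a = 0)
    (hφ' : HasFDerivAt φ (ContinuousLinearMap.id ℂ E) a) (hfa : f a = a) (hfc : ContinuousAt f a)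
    (A : E →L[ℂ] E) (hA : ∀ z ∈ D, φ (f z) = A (φ z)) (hv : A v = v) :
    ∃ ε > 0, ∃ g : ℂ → E, g 0 = a ∧ ∀ t ∈ ball (0 : ℂ) ε,
      DifferentiableAt ℂ g t ∧ g t ∈ D ∧ φ (g t) = t • v ∧ f (g t) = g t := by
  have hC : ContDiffAt ℂ 1 φ a :=
    (contDiffOn_one_of_differentiableOn hD hφ).contDiffAt (hD.mem_nhds ha)
  have hφe : HasFDerivAt φ ((ContinuousLinearEquiv.refl ℂ E : E ≃L[ℂ] E) : E →L[ℂ] E) a := hφ'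
  have hinv := hC.to_localInverse hφe one_ne_zero
  set e := hC.toOpenPartialHomeomorph φ hφe one_ne_zero
  have heφ : ∀ z, e z = φ z := fun z => rfl
  have hae : a ∈ e.source := hC.mem_toOpenPartialHomeomorph_source hφe one_ne_zero
  have h0t : (0 : E) ∈ e.target := by
    rw [← hφa]
    exact hC.image_mem_toOpenPartialHomeomorph_target hφe one_ne_zero
  have he0 : e.symm 0 = a := by
    rw [← hφa, ← heφ, e.left_inv hae]
  have hinv' : ContDiffAt ℂ 1 e.symm 0 := by
    rw [← hφa]
    exact hinv
  have hgc : Tendsto (fun t : ℂ => t • v) (𝓝 0) (𝓝 0) := by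
    have : Continuous fun t : ℂ => t • v := by fun_prop
    simpa using this.tendsto 0
  have hsymm : Tendsto e.symm (𝓝 0) (𝓝 a) := by
    simpa [he0] using hinv'.continuousAt.tendsto
  have hfs : Tendsto f (𝓝 a) (𝓝 a) := by simpa [hfa] using hfc.tendsto
  have hev : ∀ᶠ y in 𝓝 (0 : E), DifferentiableAt ℂ e.symm y ∧ y ∈ e.target ∧ e.symm y ∈ D ∧
      f (e.symm y) ∈ e.source := by
    refine (((hinv'.eventually (by simp)).mono fun y hy => hy.differentiableAt
      one_ne_zero)).and ((show ∀ᶠ y in 𝓝 (0 : E), y ∈ e.target from e.open_target.mem_nhds h0t).and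
      ((hsymm.eventually (hD.mem_nhds ha)).and ?_))
    exact (hfs.comp hsymm).eventually (e.open_source.mem_nhds hae)
  obtain ⟨ε, hε, hball⟩ := Metric.eventually_nhds_iff_ball.1 (hgc.eventually hev)
  refine ⟨ε, hε, fun t => e.symm (t • v), by simp [he0], fun t ht => ?_⟩
  obtain ⟨hd, htt, htD, hts⟩ := hball t ht
  have hφt : φ (e.symm (t • v)) = t • v := by rw [← heφ, e.right_inv htt]
  refine ⟨DifferentiableAt.comp t hd (by fun_prop), htD, hφt, ?_⟩
  -- Both `f (g t)` and `g t` lie where `φ` is injective, and `φ` sends both to `t • v`.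
  refine e.injOn hts (e.map_target htt) ?_
  rw [heφ, heφ, hA _ htD, hφt, map_smul, hv]

end LocalInverse

end ComplexAnalysis

/-! ### Compactness in equicontinuous groups of homeomorphisms. -/

section Equicontinuous

variable {X : Type*} [MetricSpace X] [LocallyCompactSpace X]

theorem isClosedEmbedding_toUniformOnFunIsCompact :
    IsClosedEmbedding (ContinuousMap.toUniformOnFunIsCompact :
      C(X, X) → UniformOnFun X X {K | IsCompact K}) := by
  refine ⟨ContinuousMap.isUniformEmbedding_toUniformOnFunIsCompact.isEmbedding, ?_⟩
  rw [ContinuousMap.range_toUniformOnFunIsCompact]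
  exact UniformOnFun.isClosed_setOfPred_continuous
    (IsCoherentWith.of_nhds exists_compact_mem_nhds)

/-- For a subset `F` of an equicontinuous group of homeomorphisms of a connected locally compact
metric space, if one orbit under `F` is relatively compact, then all of them are. -/
theorem exists_isCompact_forall_apply_mem [PreconnectedSpace X] {G : Subgroup (X ≃ₜ X)}
    (hG : ∀ x, EquicontinuousAt (fun (g : G) (y : X) => g.1 y) x) {F : Set (X ≃ₜ X)}
    (hF : F ⊆ G) {p : X} (hp : ∃ L, IsCompact L ∧ ∀ f ∈ F, f p ∈ L) (z : X) :
    ∃ L, IsCompact L ∧ ∀ f ∈ F, f z ∈ L := by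
  set S : Set X := {z | ∃ L, IsCompact L ∧ ∀ f ∈ F, f z ∈ L}
  have hopen : IsOpen S := by
    rw [isOpen_iff_mem_nhds]
    rintro z ⟨L, hL, hz⟩
    obtain ⟨δ, hδ, hLδ⟩ := hL.exists_isCompact_cthickening
    filter_upwards [Metric.equicontinuousAt_iff_right.1 (hG z) δ hδ] with w hw
    refine ⟨_, hLδ, fun f hf => mem_cthickening_of_dist_le _ (f z) _ _ (hz f hf) ?_⟩
    rw [dist_comm]
    exact (hw ⟨f, hF hf⟩).le
  have hclosed : IsClosed S := by
    refine isClosed_of_closure_subset fun z hz => ?_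
    obtain ⟨K, hK, hzK⟩ := exists_compact_mem_nhds z
    obtain ⟨r, hr, hrK⟩ := Metric.mem_nhds_iff.1 hzK
    have hr4 : 0 < r / 4 := by positivity
    obtain ⟨δ, hδ, hzδ⟩ := Metric.equicontinuousAt_iff.1 (hG z) (r / 4) hr4
    obtain ⟨y, ⟨L, hL, hy⟩, hyz⟩ := Metric.mem_closure_iff.1 hz (min δ (r / 4)) (by positivity)
    rw [lt_min_iff] at hyz
    -- Closedness: finitely many `U q` cover the orbit of a nearby `y`. If `f y` and `g q y` share a
    -- `U q`, equicontinuity of the group puts `(g q)⁻¹ (f z)` in `K`, so the orbit of `z` lies in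
    -- finitely many compact sets `g q '' K`.
    choose U hU hUd using fun q => Metric.equicontinuousAt_iff_pair.1 (hG q) (r / 4) hr4
    obtain ⟨t, -, htL⟩ := hL.elim_nhds_subcover U fun q _ => hU q
    have hex : ∀ q, ∃ g : X ≃ₜ X, (∃ f ∈ F, f y ∈ U q) → g ∈ F ∧ g y ∈ U q := by
      intro q
      by_cases h : ∃ f ∈ F, f y ∈ U q
      · obtain ⟨f, hf⟩ := h
        exact ⟨f, fun _ => hf⟩
      -- A dummy value: such a `q` is never selected below.
      · exact ⟨1, fun h' => (h h').elim⟩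
    choose g hg using hex
    refine ⟨⋃ q ∈ t, g q '' K, t.isCompact_biUnion fun q _ => hK.image (g q).continuous,
      fun f hf => ?_⟩
    obtain ⟨q, hq, hfq⟩ := mem_iUnion₂.1 (htL (hy f hf))
    obtain ⟨hgF, hgU⟩ := hg q ⟨f, hf, hfq⟩
    refine mem_iUnion₂.2 ⟨q, hq, (g q)⁻¹ (f z), hrK ?_, (g q).apply_symm_apply (f z)⟩
    have h1 : dist ((g q)⁻¹ (f y)) y < r / 4 := by
      have h := hUd q _ hfq _ hgU ⟨(g q)⁻¹, inv_mem (hF hgF)⟩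
      have e : (g q)⁻¹ (g q y) = y := (g q).symm_apply_apply y
      simpa only [e] using h
    have h2 : dist ((g q)⁻¹ (f z)) ((g q)⁻¹ (f y)) < r / 4 :=
      hzδ y (by rw [dist_comm]; exact hyz.1) ⟨(g q)⁻¹ * f, mul_mem (inv_mem (hF hgF)) (hF hf)⟩
    rw [mem_ball]
    have h3 := dist_triangle4 ((g q)⁻¹ (f z)) ((g q)⁻¹ (f y)) y z
    rw [dist_comm y z] at h3
    linarith [hyz.2]
  have huniv : S = univ := IsClopen.eq_univ ⟨hclosed, hopen⟩ ⟨p, hp⟩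
  exact huniv.ge (mem_univ z)

/-- A closed equicontinuous group of homeomorphisms acts properly. -/
theorem isCompact_image_coe_of_equicontinuous [PreconnectedSpace X] {G : Subgroup (X ≃ₜ X)}
    (hG : ∀ x, EquicontinuousAt (fun (g : G) (y : X) => g.1 y) x)
    (hGc : IsClosed {q : C(X, X) × C(X, X) | ∃ g ∈ G, (g : C(X, X)) = q.1 ∧
      ((g⁻¹ : X ≃ₜ X) : C(X, X)) = q.2})
    (p : X) {L : Set X} (hL : IsCompact L) :
    IsCompact ((fun f : X ≃ₜ X => (f : C(X, X))) '' {f | f ∈ G ∧ f p ∈ L ∧ f⁻¹ p ∈ L}) := by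
  set F : Set (X ≃ₜ X) := {f | f ∈ G ∧ f p ∈ L ∧ f⁻¹ p ∈ L}
  have hFG : F ⊆ G := fun f hf => hf.1
  have hcl : IsCompact (closure ((fun f : X ≃ₜ X => (f : C(X, X))) '' F)) := by
    refine ArzelaAscoli.isCompact_closure_of_isClosedEmbedding
      (F := fun (f : C(X, X)) (x : X) => f x) (𝔖 := {K | IsCompact K}) (fun _ h => h)
      isClosedEmbedding_toUniformOnFunIsCompact ?_ ?_
    · intro K _ x _
      refine EquicontinuousAt.equicontinuousWithinAt ?_ _
      rw [Metric.equicontinuousAt_iff_right]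
      intro ε hε
      filter_upwards [Metric.equicontinuousAt_iff_right.1 (hG x) ε hε] with y hy
      rintro ⟨_, f, hf, rfl⟩
      exact hy ⟨f, hFG hf⟩
    · intro K _ x _
      obtain ⟨Q, hQ, hxQ⟩ := exists_isCompact_forall_apply_mem hG hFG
        ⟨L, hL, fun f hf => hf.2.1⟩ x
      refine ⟨Q, hQ, ?_⟩
      rintro _ ⟨f, hf, rfl⟩
      exact hxQ f hf
  -- Working with pairs `(g, g⁻¹)` keeps limits invertible, without using continuity of inversion.
  have hpair : IsCompact ({q : C(X, X) × C(X, X) | ∃ g ∈ G, (g : C(X, X)) = q.1 ∧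
      ((g⁻¹ : X ≃ₜ X) : C(X, X)) = q.2} ∩ {q | q.1 p ∈ L ∧ q.2 p ∈ L}) := by
    refine (hcl.prod hcl).of_isClosed_subset (hGc.inter ?_) ?_
    · exact (hL.isClosed.preimage ((continuous_eval_const p).comp continuous_fst)).inter
        (hL.isClosed.preimage ((continuous_eval_const p).comp continuous_snd))
    · rintro ⟨_, _⟩ ⟨⟨g, hg, rfl, rfl⟩, h1, h2⟩
      exact ⟨subset_closure ⟨g, ⟨hg, h1, h2⟩, rfl⟩,
        subset_closure ⟨g⁻¹, ⟨inv_mem hg, h2, by rw [inv_inv]; exact h1⟩, rfl⟩⟩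
  convert hpair.image continuous_fst using 1
  ext f
  constructor
  · rintro ⟨g, ⟨hg, h1, h2⟩, rfl⟩
    exact ⟨(_, _), ⟨⟨g, hg, rfl, rfl⟩, h1, h2⟩, rfl⟩
  · rintro ⟨⟨_, _⟩, ⟨⟨g, hg, rfl, rfl⟩, h1, h2⟩, rfl⟩
    exact ⟨g, ⟨hg, h1, h2⟩, rfl⟩

end Equicontinuous

/-! ### The compact topological group of automorphisms fixing a point. -/

section Automorphisms

variable {n : ℕ} {D : Set (Fin n → ℂ)}

/-- The extension by the identity of a continuous self-map of `D`. -/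
def extendMap (f : C(D, D)) (z : Fin n → ℂ) : Fin n → ℂ :=
  open scoped Classical in if h : z ∈ D then (f ⟨z, h⟩ : Fin n → ℂ) else z

theorem extendMap_coe (f : C(D, D)) (z : D) : extendMap f z = f z := by
  simp [extendMap]

theorem continuous_coe_homeomorph : Continuous fun f : D ≃ₜ D => (f : C(D, D)) :=
  continuous_induced_dom

theorem tendstoLocallyUniformlyOn_extendMap (hD : IsOpen D) {ι : Type*} {l : Filter ι}
    {f : ι → C(D, D)} {g : C(D, D)} (h : Tendsto f l (𝓝 g)) :
    TendstoLocallyUniformlyOn (fun i => extendMap (f i)) (extendMap g) l D := by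
  have : LocallyCompactSpace D := hD.locallyCompactSpace
  rw [tendstoLocallyUniformlyOn_iff_tendstoLocallyUniformly_comp_coe]
  have h' := ContinuousMap.tendsto_iff_tendstoLocallyUniformly.1 h
  rw [Metric.tendstoLocallyUniformly_iff] at h' ⊢
  intro ε hε x
  obtain ⟨t, ht, hx⟩ := h' ε hε x
  refine ⟨t, ht, ?_⟩
  filter_upwards [hx] with i hi y hy
  simpa only [Function.comp_apply, extendMap_coe, Subtype.dist_eq] using hi y hy

theorem tendstoLocallyUniformlyOn_toMap (hD : IsOpen D) {ι : Type*} {l : Filter ι}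
    {f : ι → D ≃ₜ D} {g : D ≃ₜ D} (h : Tendsto f l (𝓝 g)) :
    TendstoLocallyUniformlyOn (fun i => toMap (f i)) (toMap g) l D :=
  tendstoLocallyUniformlyOn_extendMap hD ((continuous_coe_homeomorph.tendsto g).comp h)

theorem isClosed_differentiableOn_extendMap (hD : IsOpen D) :
    IsClosed {f : C(D, D) | DifferentiableOn ℂ (extendMap f) D} := by
  refine isClosed_of_closure_subset fun f hf => ?_
  have : (𝓝[{f : C(D, D) | DifferentiableOn ℂ (extendMap f) D}] f).NeBot :=
    mem_closure_iff_nhdsWithin_neBot.1 hf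
  exact differentiableOn_of_tendstoLocallyUniformlyOn (G := fun f : C(D, D) => extendMap f)
    (l := 𝓝[{f : C(D, D) | DifferentiableOn ℂ (extendMap f) D}] f) hD
    (tendstoLocallyUniformlyOn_extendMap hD (tendsto_id.mono_left nhdsWithin_le_nhds))
    self_mem_nhdsWithin

/-- For a pair of maps, being mutually inverse and both holomorphic are closed conditions, whereas a
limit of automorphisms alone may fail to be invertible. -/
theorem isClosed_holAut_pairs (hD : IsOpen D) :
    IsClosed {q : C(D, D) × C(D, D) | ∃ g ∈ holAut D, (g : C(D, D)) = q.1 ∧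
      ((g⁻¹ : D ≃ₜ D) : C(D, D)) = q.2} := by
  have : LocallyCompactSpace D := hD.locallyCompactSpace
  have h : {q : C(D, D) × C(D, D) | ∃ g ∈ holAut D, (g : C(D, D)) = q.1 ∧
      ((g⁻¹ : D ≃ₜ D) : C(D, D)) = q.2} =
      {q | q.1.comp q.2 = ContinuousMap.id D} ∩ {q | q.2.comp q.1 = ContinuousMap.id D} ∩
      ({q | DifferentiableOn ℂ (extendMap q.1) D} ∩
        {q | DifferentiableOn ℂ (extendMap q.2) D}) := by
    ext ⟨u, v⟩
    constructor
    · rintro ⟨g, ⟨hg, hg'⟩, rfl, rfl⟩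
      refine ⟨⟨?_, ?_⟩, hg, hg'⟩
      · ext1 x
        exact g.apply_symm_apply x
      · ext1 x
        exact g.symm_apply_apply x
    · rintro ⟨⟨huv, hvu⟩, hu, hv⟩
      refine ⟨⟨⟨u, v, fun x => DFunLike.congr_fun hvu x, fun x => DFunLike.congr_fun huv x⟩,
        u.continuous, v.continuous⟩, ⟨hu, hv⟩, rfl, rfl⟩
  rw [h]
  have hc1 : Continuous fun q : C(D, D) × C(D, D) => q.1.comp q.2 :=
    ContinuousMap.continuous_comp'.comp continuous_swap
  have hc2 : Continuous fun q : C(D, D) × C(D, D) => q.2.comp q.1 :=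
    ContinuousMap.continuous_comp'
  exact ((isClosed_eq hc1 continuous_const).inter (isClosed_eq hc2 continuous_const)).inter
    (((isClosed_differentiableOn_extendMap hD).preimage continuous_fst).inter
      ((isClosed_differentiableOn_extendMap hD).preimage continuous_snd))

theorem exists_norm_toMap_le (hDb : Bornology.IsBounded D) :
    ∃ M : ℝ, ∀ (f : D ≃ₜ D), ∀ z ∈ D, ‖toMap f z‖ ≤ M := by
  obtain ⟨M, hM⟩ := hDb.exists_norm_le
  exact ⟨M, fun f z hz => hM _ (mapsTo_toMap f hz)⟩

/-- Boundedness of `D` enters here: it gives a local Lipschitz constant common to all automorphisms.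
-/
theorem equicontinuousAt_holAut (hD : IsOpen D) (hDb : Bornology.IsBounded D) (x : D) :
    EquicontinuousAt (fun (g : holAut D) (y : D) => g.1 y) x := by
  obtain ⟨M, hM⟩ := exists_norm_toMap_le hDb
  obtain ⟨r, hr, hrD⟩ := Metric.isOpen_iff.1 hD x x.2
  refine Metric.equicontinuousAt_of_continuity_modulus
    (fun y : D => 2 * M / r * ‖(y : Fin n → ℂ) - x‖) ?_ _ ?_
  · have : Continuous fun y : D => 2 * M / r * ‖(y : Fin n → ℂ) - x‖ := by fun_prop
    simpa using this.tendsto x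
  · filter_upwards [ball_mem_nhds x hr] with y hy g
    rw [dist_comm, Subtype.dist_eq, dist_eq_norm, ← toMap_coe, ← toMap_coe]
    exact norm_sub_le_of_norm_le hr (g.2.1.mono hrD) (fun z hz => hM _ z (hrD hz)) hy

theorem isCompact_holAut_apply_mem (hD : IsOpen D) (hDc : IsConnected D)
    (hDb : Bornology.IsBounded D) (p : D) {L : Set D} (hL : IsCompact L) :
    IsCompact {f : D ≃ₜ D | f ∈ holAut D ∧ f p ∈ L ∧ f⁻¹ p ∈ L} := by
  have : LocallyCompactSpace D := hD.locallyCompactSpace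
  have : PreconnectedSpace D := isPreconnected_iff_preconnectedSpace.1 hDc.isPreconnected
  have hind : IsInducing fun f : D ≃ₜ D => (f : C(D, D)) := ⟨rfl⟩
  rw [hind.isCompact_iff]
  exact isCompact_image_coe_of_equicontinuous (equicontinuousAt_holAut hD hDb)
    (isClosed_holAut_pairs hD) p hL

variable (a : D)

theorem compactSpace_isotropy (hD : IsOpen D) (hDc : IsConnected D)
    (hDb : Bornology.IsBounded D) : CompactSpace (isotropy D a) := by
  refine (isCompact_iff_compactSpace (s := (isotropy D a : Set (D ≃ₜ D)))).1 ?_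
  convert isCompact_holAut_apply_mem hD hDc hDb a (isCompact_singleton (x := a)) using 1
  ext f
  constructor
  · intro hf
    exact ⟨hf.1, hf.2, (inv_mem hf : f⁻¹ ∈ isotropy D a).2⟩
  · intro hf
    exact ⟨hf.1, hf.2.1⟩

instance : T2Space (isotropy D a) :=
  T2Space.of_injective_continuous (f := fun f : isotropy D a => ((f : D ≃ₜ D) : C(D, D)))
    (fun _ _ h => Subtype.ext (Homeomorph.ext fun x => DFunLike.congr_fun h x))
    (continuous_coe_homeomorph.comp continuous_subtype_val)

theorem isTopologicalGroup_isotropy (hD : IsOpen D) (hDc : IsConnected D)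
    (hDb : Bornology.IsBounded D) : IsTopologicalGroup (isotropy D a) := by
  have : LocallyCompactSpace D := hD.locallyCompactSpace
  have := compactSpace_isotropy a hD hDc hDb
  have hcoe : Continuous fun f : isotropy D a => ((f : D ≃ₜ D) : C(D, D)) :=
    continuous_coe_homeomorph.comp continuous_subtype_val
  have hmul : ContinuousMul (isotropy D a) := by
    refine ⟨continuous_induced_rng.2 (continuous_induced_rng.2 ?_)⟩
    exact ContinuousMap.continuous_comp'.comp
      ((hcoe.comp continuous_snd).prodMk (hcoe.comp continuous_fst))
  refine { hmul with continuous_inv := ?_ }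
  -- The graph of inversion is compact, so its continuous bijective projection to the Hausdorff
  -- first factor is a homeomorphism.
  set P : Set (isotropy D a × isotropy D a) := {q | q.1 * q.2 = 1}
  have hP : IsClosed P := isClosed_eq continuous_mul continuous_const
  have : CompactSpace P := isCompact_iff_compactSpace.1 hP.isCompact
  let e : P ≃ isotropy D a :=
    { toFun := fun q => q.1.1
      invFun := fun f => ⟨(f, f⁻¹), mul_inv_cancel f⟩
      left_inv := fun q => Subtype.ext (Prod.ext rfl (inv_eq_of_mul_eq_one_right q.2))
      right_inv := fun _ => rfl }
  have he : Continuous e := continuous_fst.comp continuous_subtype_val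
  exact (continuous_snd.comp continuous_subtype_val).comp
    he.continuous_symm_of_equiv_compact_to_t2

end Automorphisms

/-- Haar probability measures are right invariant. -/
theorem integral_mul_right_eq_self_of_isHaarMeasure {G E : Type*} [Group G] [TopologicalSpace G]
    [IsTopologicalGroup G] [LocallyCompactSpace G] [MeasurableSpace G] [BorelSpace G]
    [NormedAddCommGroup E] [NormedSpace ℝ E] (ν : Measure G) [ν.IsHaarMeasure]
    [IsProbabilityMeasure ν] (u : G → E) (g : G) : ∫ x, u (x * g) ∂ν = ∫ x, u x ∂ν := by
  have hν : ν.IsMulRightInvariant := by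
    refine ⟨fun g => ?_⟩
    have : IsProbabilityMeasure (ν.map (· * g)) :=
      Measure.isProbabilityMeasure_map (continuous_mul_const g).measurable.aemeasurable
    exact Measure.isHaarMeasure_eq_of_isProbabilityMeasure _ _
  exact integral_mul_right_eq_self u g

/-! ### Cartan's averaged map and its equivariance. -/

section CartanMap

variable {n : ℕ} {D : Set (Fin n → ℂ)} {a : D}

theorem differentiableAt_toMap (hD : IsOpen D) {f : D ≃ₜ D} (hf : f ∈ holAut D)
    {z : Fin n → ℂ} (hz : z ∈ D) : DifferentiableAt ℂ (toMap f) z :=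
  hf.1.differentiableAt (hD.mem_nhds hz)

theorem toMap_apply_self (f : isotropy D a) : toMap f.1 a = a := by
  rw [toMap_coe, f.2.2]

theorem fderiv_toMap_mul (hD : IsOpen D) (f g : isotropy D a) :
    fderiv ℂ (toMap (f * g).1) a = fderiv ℂ (toMap f.1) a ∘L fderiv ℂ (toMap g.1) a := by
  have h : toMap (f * g).1 = toMap f.1 ∘ toMap g.1 := funext fun z => toMap_mul f.1 g.1 z
  rw [h, fderiv_comp (a : Fin n → ℂ), toMap_apply_self]
  · rw [toMap_apply_self]
    exact differentiableAt_toMap hD f.2.1 a.2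
  · exact differentiableAt_toMap hD g.2.1 a.2

theorem fderiv_toMap_one : fderiv ℂ (toMap (1 : isotropy D a).1) a =
    ContinuousLinearMap.id ℂ (Fin n → ℂ) := by
  rw [OneMemClass.coe_one, toMap_one]
  exact fderiv_id

/-- This form reduces continuity of `f ↦ f'(a)⁻¹` to continuity of inversion in the group. -/
theorem inverse_fderiv_toMap (hD : IsOpen D) (f : isotropy D a) :
    (fderiv ℂ (toMap f.1) a).inverse = fderiv ℂ (toMap (f⁻¹).1) a := by
  refine ContinuousLinearMap.inverse_eq ?_ ?_
  · rw [← fderiv_toMap_mul hD, mul_inv_cancel, fderiv_toMap_one]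
  · rw [← fderiv_toMap_mul hD, inv_mul_cancel, fderiv_toMap_one]

theorem cartanIntegrand_eq (hD : IsOpen D) (ζ : Fin n → ℂ) (f : isotropy D a) :
    cartanIntegrand a ζ f = fderiv ℂ (toMap (f⁻¹).1) a (toMap f.1 ζ - a) := by
  rw [cartanIntegrand, inverse_fderiv_toMap hD]

theorem continuous_fderiv_toMap (hD : IsOpen D) {ζ : Fin n → ℂ} (hζ : ζ ∈ D) :
    Continuous fun f : isotropy D a => fderiv ℂ (toMap f.1) ζ := by
  rw [continuous_iff_continuousAt]
  intro f
  exact tendsto_fderiv_of_tendstoLocallyUniformlyOn hD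
    (tendstoLocallyUniformlyOn_toMap hD (continuous_subtype_val.tendsto f))
    (Eventually.of_forall fun g => g.2.1.1) hζ

theorem continuous_toMap_apply {ζ : Fin n → ℂ} (hζ : ζ ∈ D) :
    Continuous fun f : isotropy D a => toMap f.1 ζ := by
  have h : Continuous fun f : isotropy D a => ((f : D ≃ₜ D) : C(D, D)) :=
    continuous_coe_homeomorph.comp continuous_subtype_val
  have h2 := continuous_subtype_val.comp ((continuous_eval_const (⟨ζ, hζ⟩ : D)).comp h)
  exact h2.congr fun f => (toMap_coe f.1 ⟨ζ, hζ⟩).symm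

theorem continuous_cartanIntegrand [IsTopologicalGroup (isotropy D a)] (hD : IsOpen D)
    {ζ : Fin n → ℂ} (hζ : ζ ∈ D) : Continuous (cartanIntegrand a ζ) := by
  have h : cartanIntegrand a ζ = fun f =>
      fderiv ℂ (toMap (f⁻¹).1) a (toMap f.1 ζ - (a : Fin n → ℂ)) :=
    funext (cartanIntegrand_eq hD ζ)
  rw [h]
  exact ((continuous_fderiv_toMap hD a.2).comp continuous_inv).clm_apply
    ((continuous_toMap_apply hζ).sub continuous_const)

theorem norm_fderiv_toMap_le (hDb : Bornology.IsBounded D) :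
    ∃ M : ℝ, ∀ f ∈ holAut D, ∀ z r, 0 < r → ball z r ⊆ D → ‖fderiv ℂ (toMap f) z‖ ≤ 2 * M / r := by
  obtain ⟨M, hM⟩ := exists_norm_toMap_le hDb
  exact ⟨M, fun f hf z r hr hz =>
    norm_fderiv_le_of_norm_le hr (hf.1.mono hz) fun w hw => hM f w (hz hw)⟩

theorem cartanMap_self (μ : Measure (isotropy D a)) : cartanMap a μ a = 0 := by
  simp [cartanMap, cartanIntegrand, toMap_apply_self]

theorem integrable_cartanIntegrand [IsTopologicalGroup (isotropy D a)]
    [CompactSpace (isotropy D a)] (μ : Measure (isotropy D a)) [μ.IsHaarMeasure] (hD : IsOpen D)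
    {ζ : Fin n → ℂ} (hζ : ζ ∈ D) :
    Integrable (cartanIntegrand a ζ) μ :=
  (continuous_cartanIntegrand hD hζ).integrable_of_hasCompactSupport
    (HasCompactSupport.of_compactSpace _)

section Measure

variable [IsTopologicalGroup (isotropy D a)] [CompactSpace (isotropy D a)]
  (μ : Measure (isotropy D a)) [μ.IsHaarMeasure] [IsProbabilityMeasure μ]

theorem hasFDerivAt_cartanMap (hD : IsOpen D) (hDb : Bornology.IsBounded D) {ζ : Fin n → ℂ}
    (hζ : ζ ∈ D) :
    HasFDerivAt (cartanMap a μ)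
      (∫ f : isotropy D a, fderiv ℂ (toMap (f⁻¹).1) a ∘L fderiv ℂ (toMap f.1) ζ ∂μ) ζ := by
  obtain ⟨M, hM⟩ := norm_fderiv_toMap_le hDb
  obtain ⟨r, hr, hrD⟩ := Metric.isOpen_iff.1 hD ζ hζ
  obtain ⟨s, hs, hsD⟩ := Metric.isOpen_iff.1 hD a a.2
  have hr2 : 0 < r / 2 := by positivity
  have hsub : ∀ z ∈ ball ζ (r / 2), ball z (r / 2) ⊆ D := fun z hz =>
    (ball_subset_ball' (by rw [mem_ball] at hz; linarith)).trans hrD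
  have hsub' : ball ζ (r / 2) ⊆ D := (ball_subset_ball (by linarith)).trans hrD
  have hcont : Continuous fun f : isotropy D a =>
      fderiv ℂ (toMap (f⁻¹).1) a ∘L fderiv ℂ (toMap f.1) ζ :=
    ((continuous_fderiv_toMap hD a.2).comp continuous_inv).clm_comp
      (continuous_fderiv_toMap hD hζ)
  refine hasFDerivAt_integral_of_dominated_of_fderiv_le (𝕜 := ℂ) (μ := μ)
    (F := fun z f => cartanIntegrand a z f)
    (F' := fun z f => fderiv ℂ (toMap (f⁻¹).1) a ∘L fderiv ℂ (toMap f.1) z)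
    (bound := fun _ => 2 * M / s * (2 * M / (r / 2))) (ball_mem_nhds ζ hr2) ?_
    (integrable_cartanIntegrand μ hD hζ) ?_ ?_ (integrable_const _) ?_
  · filter_upwards [ball_mem_nhds ζ hr2] with z hz
    exact (integrable_cartanIntegrand μ hD (hsub' hz)).aestronglyMeasurable
  · exact (hcont.integrable_of_hasCompactSupport
      (HasCompactSupport.of_compactSpace _)).aestronglyMeasurable
  · refine Eventually.of_forall fun f z hz => ?_
    have h1 := hM _ (f⁻¹).2.1 a s hs hsD
    have h2 := hM _ f.2.1 z (r / 2) hr2 (hsub z hz)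
    exact (ContinuousLinearMap.opNorm_comp_le _ _).trans
      (mul_le_mul h1 h2 (norm_nonneg _) ((norm_nonneg _).trans h1))
  · refine Eventually.of_forall fun f z hz => ?_
    simp only [cartanIntegrand_eq hD]
    exact (fderiv ℂ (toMap (f⁻¹).1) a).hasFDerivAt.comp z
      ((differentiableAt_toMap hD f.2.1 (hsub' hz)).hasFDerivAt.sub_const _)

theorem differentiableOn_cartanMap (hD : IsOpen D) (hDb : Bornology.IsBounded D) :
    DifferentiableOn ℂ (cartanMap a μ) D := fun _ hζ =>
  (hasFDerivAt_cartanMap μ hD hDb hζ).differentiableAt.differentiableWithinAt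

theorem hasFDerivAt_cartanMap_self (hD : IsOpen D) (hDb : Bornology.IsBounded D) :
    HasFDerivAt (cartanMap a μ) (ContinuousLinearMap.id ℂ (Fin n → ℂ)) (a : Fin n → ℂ) := by
  convert hasFDerivAt_cartanMap μ hD hDb a.2 using 1
  have h : ∀ f : isotropy D a, fderiv ℂ (toMap (f⁻¹).1) a ∘L fderiv ℂ (toMap f.1) a =
      ContinuousLinearMap.id ℂ (Fin n → ℂ) := fun f => by
    rw [← fderiv_toMap_mul hD, inv_mul_cancel, fderiv_toMap_one]
  rw [integral_congr_ae (Eventually.of_forall h)]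
  simp

/-- By the chain rule `f'(a)⁻¹ = g'(a) (f g)'(a)⁻¹`, so the integrand at `g ζ` is `g'(a)` applied to
the integrand at `ζ` for `f g`; right invariance removes the translation. -/
theorem cartanMap_toMap (hD : IsOpen D) (g : isotropy D a) {ζ : Fin n → ℂ} (hζ : ζ ∈ D) :
    cartanMap a μ (toMap g.1 ζ) = fderiv ℂ (toMap g.1) a (cartanMap a μ ζ) := by
  have h : ∀ f : isotropy D a, cartanIntegrand a (toMap g.1 ζ) f =
      fderiv ℂ (toMap g.1) a (cartanIntegrand a ζ (f * g)) := by
    intro f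
    have h1 : fderiv ℂ (toMap (f⁻¹).1) a =
        fderiv ℂ (toMap g.1) a ∘L fderiv ℂ (toMap ((f * g)⁻¹).1) a := by
      rw [← fderiv_toMap_mul hD, mul_inv_rev, mul_inv_cancel_left]
    rw [cartanIntegrand_eq hD, cartanIntegrand_eq hD, h1]
    have h2 : toMap (f * g).1 ζ = toMap f.1 (toMap g.1 ζ) := toMap_mul f.1 g.1 ζ
    rw [h2]
    rfl
  rw [cartanMap, integral_congr_ae (Eventually.of_forall h),
    integral_mul_right_eq_self_of_isHaarMeasure μ
      (fun f => fderiv ℂ (toMap g.1) a (cartanIntegrand a ζ f)) g,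
    ContinuousLinearMap.integral_comp_comm _ (integrable_cartanIntegrand μ hD hζ)]
  rfl

end Measure

end CartanMap

/-! ### Dimension bounds through embedded submanifolds. -/

section Dimension

variable {n : ℕ}

/-- A submanifold contained in a set with empty interior has positive codimension. -/
theorem ContainsSubmanifold.lt_of_interior_eq_empty {k : ℕ} {A : Set (Fin n → ℂ)}
    (h : ContainsSubmanifold k A) (hA : interior A = ∅) : k < n := by
  obtain ⟨U, g, hU, ⟨u, hu⟩, hg, -, hinj, hmaps⟩ := h
  have hkn : k ≤ n := by
    simpa using LinearMap.finrank_le_finrank_of_injective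
      (f := (fderiv ℂ g u : (Fin k → ℂ) →ₗ[ℂ] (Fin n → ℂ))) (hinj u hu)
  -- In equal dimensions the inverse function theorem would make `A` a neighbourhood of `g u`.
  refine lt_of_le_of_ne hkn fun hk => ?_
  subst hk
  set e : (Fin k → ℂ) ≃L[ℂ] (Fin k → ℂ) :=
    (LinearEquiv.ofInjectiveEndo (fderiv ℂ g u : (Fin k → ℂ) →ₗ[ℂ] (Fin k → ℂ))
      (hinj u hu)).toContinuousLinearEquiv
  have he : HasStrictFDerivAt g (e : (Fin k → ℂ) →L[ℂ] (Fin k → ℂ)) u := by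
    have h : (e : (Fin k → ℂ) →L[ℂ] (Fin k → ℂ)) = fderiv ℂ g u :=
      ContinuousLinearMap.ext fun _ => rfl
    rw [h]
    exact hasStrictFDerivAt_of_differentiableOn hU hg hu
  have hmem : A ∈ 𝓝 (g u) := by
    rw [← he.map_nhds_eq_of_equiv]
    exact mem_map.2 (mem_of_superset (hU.mem_nhds hu) hmaps)
  exact notMem_empty _ (hA ▸ mem_interior_iff_mem_nhds.2 hmem)

theorem complexDim_lt_of_interior_eq_empty (hn : 1 ≤ n) {A : Set (Fin n → ℂ)}
    (hA : interior A = ∅) : complexDim A < n := by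
  have h : complexDim A ≤ (((n - 1 : ℕ) : ℕ∞) : WithBot ℕ∞) := by
    refine iSup₂_le fun k hk => ?_
    have := hk.lt_of_interior_eq_empty hA
    exact_mod_cast Nat.le_sub_one_of_lt this
  refine h.trans_lt ?_
  have : n - 1 < n := by omega
  exact_mod_cast this

/-- A holomorphic curve on which some holomorphic map is a non-constant linear function of the
parameter is an embedded submanifold of dimension one. -/
theorem containsSubmanifold_one {D A : Set (Fin n → ℂ)} (hD : IsOpen D)
    {φ : (Fin n → ℂ) → (Fin n → ℂ)} (hφ : DifferentiableOn ℂ φ D) {g : ℂ → (Fin n → ℂ)} {ε : ℝ}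
    (hε : 0 < ε) {v : Fin n → ℂ} (hv : v ≠ 0)
    (hg : ∀ t ∈ ball (0 : ℂ) ε, DifferentiableAt ℂ g t ∧ g t ∈ D ∧ φ (g t) = t • v ∧ g t ∈ A) :
    ContainsSubmanifold 1 A := by
  have hU : IsOpen {u : Fin 1 → ℂ | u 0 ∈ ball (0 : ℂ) ε} :=
    isOpen_ball.preimage (continuous_apply 0)
  have hgd : ∀ u : Fin 1 → ℂ, u 0 ∈ ball (0 : ℂ) ε →
      DifferentiableAt ℂ (fun u : Fin 1 → ℂ => g (u 0)) u := fun u hu =>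
    (hg _ hu).1.comp u (differentiableAt_apply 0 u)
  refine ⟨{u | u 0 ∈ ball (0 : ℂ) ε}, fun u => g (u 0), hU, ⟨0, by simpa using hε⟩,
    fun u hu => (hgd u hu).differentiableWithinAt, ?_, ?_, fun u hu => (hg _ hu).2.2.2⟩
  · intro u hu w hw huw
    have h : (u 0) • v = (w 0) • v := by
      rw [← (hg _ hu).2.2.1, ← (hg _ hw).2.2.1]
      exact congrArg φ huw
    have h0 : u 0 = w 0 := smul_left_injective ℂ hv h
    exact funext fun i => by rwa [Subsingleton.elim i 0]
  · intro u hu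
    have h1 : HasFDerivAt (fun u : Fin 1 → ℂ => φ (g (u 0)))
        (fderiv ℂ φ (g (u 0)) ∘L fderiv ℂ (fun u : Fin 1 → ℂ => g (u 0)) u) u :=
      (hφ.differentiableAt (hD.mem_nhds (hg _ hu).2.1)).hasFDerivAt.comp u (hgd u hu).hasFDerivAt
    have h2 : HasFDerivAt (fun u : Fin 1 → ℂ => φ (g (u 0)))
        ((ContinuousLinearMap.proj (R := ℂ) (φ := fun _ : Fin 1 => ℂ) 0).smulRight v) u := by
      refine ((ContinuousLinearMap.proj (R := ℂ) (φ := fun _ : Fin 1 => ℂ) 0).smulRight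
        v).hasFDerivAt.congr_of_eventuallyEq ?_
      filter_upwards [hU.mem_nhds hu] with w hw
      exact (hg _ hw).2.2.1
    refine (injective_iff_map_eq_zero _).2 fun w hw => ?_
    have h3 := DFunLike.congr_fun (h1.unique h2) w
    simp only [ContinuousLinearMap.comp_apply, hw, map_zero,
      ContinuousLinearMap.smulRight_apply, ContinuousLinearMap.proj_apply] at h3
    have h0 : w 0 = 0 := (smul_eq_zero.1 h3.symm).resolve_right hv
    exact funext fun i => by rwa [Subsingleton.elim i 0]

end Dimension

/-! ### The zero set of the Cartan map and curves of fixed points. -/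

section CartanMap

variable {n : ℕ} {D : Set (Fin n → ℂ)} {a : D}
  [IsTopologicalGroup (isotropy D a)] [CompactSpace (isotropy D a)]
  (μ : Measure (isotropy D a)) [μ.IsHaarMeasure] [IsProbabilityMeasure μ]

/-- An interior zero would force the map to vanish on all of `D`, contradicting that its derivative
at `a` is the identity. -/
theorem interior_cartanZeroSet (hn : 1 ≤ n) (hD : IsOpen D) (hDc : IsConnected D)
    (hDb : Bornology.IsBounded D) : interior (cartanZeroSet a μ) = ∅ := by
  by_contra hne
  obtain ⟨p, hp⟩ := nonempty_iff_ne_empty.2 hne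
  have hpD : p ∈ D := (interior_subset hp).1
  have h0 : cartanMap a μ =ᶠ[𝓝 p] 0 :=
    mem_of_superset (mem_interior_iff_mem_nhds.1 hp) fun z hz => hz.2
  have hEq := eqOn_zero_of_preconnected_of_eventuallyEq_zero hD hDc.isPreconnected
    (differentiableOn_cartanMap μ hD hDb) hpD h0
  have h1 : HasFDerivAt (cartanMap a μ) (0 : (Fin n → ℂ) →L[ℂ] (Fin n → ℂ)) (a : Fin n → ℂ) :=
    (hasFDerivAt_const (0 : Fin n → ℂ) (a : Fin n → ℂ)).congr_of_eventuallyEq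
      (mem_of_superset (hD.mem_nhds a.2) hEq)
  have h2 := DFunLike.congr_fun ((hasFDerivAt_cartanMap_self μ hD hDb).unique h1)
    (fun _ => (1 : ℂ))
  simpa using congrFun h2 ⟨0, hn⟩

theorem cartanZeroSet_ne (hn : 1 ≤ n) (hD : IsOpen D) (hDc : IsConnected D)
    (hDb : Bornology.IsBounded D) : cartanZeroSet a μ ≠ D := fun h => by
  have h1 := interior_cartanZeroSet μ hn hD hDc hDb
  rw [h, hD.interior_eq] at h1
  exact hDc.nonempty.ne_empty h1

theorem isAnalyticSubset_cartanZeroSet (hD : IsOpen D) (hDb : Bornology.IsBounded D) :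
    IsAnalyticSubset D (cartanZeroSet a μ) := by
  refine ⟨fun z hz => hz.1, fun p hp => ⟨D, hD, hp, Subset.rfl, n, fun i z => cartanMap a μ z i,
    fun i => ?_, ?_⟩⟩
  · exact differentiableOn_pi.1 (differentiableOn_cartanMap μ hD hDb) i
  · ext z
    constructor
    · rintro ⟨hz, -⟩
      exact ⟨hz.1, fun i => congrFun hz.2 i⟩
    · rintro ⟨hz, h⟩
      exact ⟨⟨hz, funext h⟩, hz⟩

theorem volume_cartanZeroSet (hn : 1 ≤ n) (hD : IsOpen D) (hDc : IsConnected D)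
    (hDb : Bornology.IsBounded D) : volume (cartanZeroSet a μ) = 0 := by
  refine measure_zeros_eq_zero volume hD hDc.isPreconnected
    (differentiableOn_cartanMap μ hD hDb) ?_
  by_contra! h
  exact cartanZeroSet_ne μ hn hD hDc hDb (Subset.antisymm (fun z hz => hz.1)
    fun z hz => ⟨hz, h z hz⟩)

/-- Each eigenvector with eigenvalue `1` of the derivative at `a` of an automorphism fixing `a` is
tangent to a holomorphic curve of fixed points. -/
theorem exists_curve_of_fderiv_apply_eq (hD : IsOpen D) (hDb : Bornology.IsBounded D)
    (f : isotropy D a) {v : Fin n → ℂ} (hv : fderiv ℂ (toMap f.1) a v = v) :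
    ∃ ε > 0, ∃ g : ℂ → (Fin n → ℂ), g 0 = a ∧ ∀ t ∈ ball (0 : ℂ) ε,
      DifferentiableAt ℂ g t ∧ g t ∈ D ∧ cartanMap a μ (g t) = t • v ∧ toMap f.1 (g t) = g t :=
  exists_curve_of_fixed_points hD a.2 (differentiableOn_cartanMap μ hD hDb) (cartanMap_self μ)
    (hasFDerivAt_cartanMap_self μ hD hDb) (toMap_apply_self f)
    (differentiableAt_toMap hD f.2.1 a.2).continuousAt _
    (fun _ hz => cartanMap_toMap μ hD f hz) hv

theorem fderiv_apply_cartanMap (hD : IsOpen D) (f : isotropy D a) {b : D} (hb : f.1 b = b) :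
    fderiv ℂ (toMap f.1) a (cartanMap a μ b) = cartanMap a μ b := by
  rw [← cartanMap_toMap μ hD f b.2, toMap_coe, hb]

theorem one_le_complexDim_fixSet (hD : IsOpen D) (hDb : Bornology.IsBounded D)
    (f : isotropy D a) {b : D} (hb : f.1 b = b) (hbZ : (b : Fin n → ℂ) ∉ cartanZeroSet a μ) :
    1 ≤ complexDim (fixSet f.1) := by
  have hv : cartanMap a μ b ≠ 0 := fun h => hbZ ⟨b.2, h⟩
  obtain ⟨ε, hε, g, -, hg⟩ := exists_curve_of_fderiv_apply_eq μ hD hDb f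
    (fderiv_apply_cartanMap μ hD f hb)
  have h : ContainsSubmanifold 1 (fixSet f.1) :=
    containsSubmanifold_one hD (differentiableOn_cartanMap μ hD hDb) hε hv fun t ht =>
      ⟨(hg t ht).1, (hg t ht).2.1, (hg t ht).2.2.1, (hg t ht).2.1, (hg t ht).2.2.2⟩
  exact le_iSup₂_of_le (f := fun (k : ℕ) (_ : ContainsSubmanifold k (fixSet f.1)) =>
    ((k : ℕ∞) : WithBot ℕ∞)) 1 h (by simp)

end CartanMap

/-! ### Measurable covering of the bad pairs and Fubini. -/

section FixedPairs

variable {n : ℕ} {D : Set (Fin n → ℂ)}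

theorem exists_isHaarMeasure_isProbabilityMeasure {G : Type*} [Group G] [TopologicalSpace G]
    [IsTopologicalGroup G] [CompactSpace G] [MeasurableSpace G] [BorelSpace G] :
    ∃ μ : Measure G, μ.IsHaarMeasure ∧ IsProbabilityMeasure μ :=
  ⟨Measure.haarMeasure ⊤, inferInstance, ⟨Measure.haarMeasure_self (K₀ := ⊤)⟩⟩

/-- The pairs of fixed points `(a, b)` of members `f` of a family `K` for which `a` is an isolated
and non-degenerate fixed point, quantitatively in terms of `c`. -/
def isolatedFixedPairs (K : Set (D ≃ₜ D)) (c : ℝ) : Set (D × D) :=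
  {q | ∃ f ∈ K, f q.1 = q.1 ∧ f q.2 = q.2 ∧
    ∀ z : D, 1 ≤ c * dist z q.1 ∨ dist z q.1 ≤ c * dist (f z) z}

theorem continuous_apply_homeomorph (hD : IsOpen D) :
    Continuous fun q : (D ≃ₜ D) × D => q.1 q.2 := by
  have : LocallyCompactSpace D := hD.locallyCompactSpace
  exact (continuous_eval (F := C(D, D))).comp
    ((continuous_coe_homeomorph.comp continuous_fst).prodMk continuous_snd)

/-- For each `z` the alternative is a closed condition on `(f, q)`, and projecting along the compact
`K` preserves closedness. -/
theorem isClosed_isolatedFixedPairs (hD : IsOpen D) {K : Set (D ≃ₜ D)} (hK : IsCompact K) (c : ℝ) :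
    IsClosed (isolatedFixedPairs K c) := by
  have : CompactSpace K := isCompact_iff_compactSpace.1 hK
  have happ : ∀ {g : K × (D × D) → D}, Continuous g → Continuous fun q : K × (D × D) =>
      (q.1 : D ≃ₜ D) (g q) := fun hg => (continuous_apply_homeomorph hD).comp
    ((continuous_subtype_val.comp continuous_fst).prodMk hg)
  have h1 : Continuous fun q : K × (D × D) => q.2.1 := continuous_fst.comp continuous_snd
  have h2 : Continuous fun q : K × (D × D) => q.2.2 := continuous_snd.comp continuous_snd
  have hcl : IsClosed ({q : K × (D × D) | (q.1 : D ≃ₜ D) q.2.1 = q.2.1} ∩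
      ({q | (q.1 : D ≃ₜ D) q.2.2 = q.2.2} ∩
        ⋂ z : D, ({q | 1 ≤ c * dist z q.2.1} ∪
          {q | dist z q.2.1 ≤ c * dist ((q.1 : D ≃ₜ D) z) z}))) := by
    refine (isClosed_eq (happ h1) h1).inter ((isClosed_eq (happ h2) h2).inter
      (isClosed_iInter fun z => IsClosed.union ?_ ?_))
    · exact isClosed_le continuous_const (continuous_const.mul (continuous_const.dist h1))
    · exact isClosed_le (continuous_const.dist h1)
        (continuous_const.mul ((happ continuous_const).dist continuous_const))
  convert isClosedMap_snd_of_compactSpace _ hcl using 1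
  ext q
  constructor
  · rintro ⟨f, hf, hq1, hq2, hz⟩
    exact ⟨(⟨f, hf⟩, q), ⟨hq1, hq2, mem_iInter.2 hz⟩, rfl⟩
  · rintro ⟨⟨f, q⟩, ⟨hq1, hq2, hz⟩, rfl⟩
    exact ⟨f.1, f.2, hq1, hq2, mem_iInter.1 hz⟩

/-- The automorphisms with a fixed point near `p` form a relatively compact set. -/
theorem exists_isCompact_of_fixed_point (hD : IsOpen D) (hDc : IsConnected D)
    (hDb : Bornology.IsBounded D) (p : D) :
    ∃ K : Set (D ≃ₜ D), IsCompact K ∧ K ⊆ holAut D ∧ ∃ V ∈ 𝓝 p, ∀ f ∈ holAut D, ∀ a ∈ V,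
      f a = a → f ∈ K := by
  have : LocallyCompactSpace D := hD.locallyCompactSpace
  obtain ⟨L, hL, hpL⟩ := exists_compact_mem_nhds p
  obtain ⟨r, hr, hrL⟩ := Metric.mem_nhds_iff.1 hpL
  have hr2 : 0 < r / 2 := by positivity
  refine ⟨_, isCompact_holAut_apply_mem hD hDc hDb p hL, fun f hf => hf.1, _,
    inter_mem (Metric.equicontinuousAt_iff_right.1 (equicontinuousAt_holAut hD hDb p) (r / 2) hr2)
      (ball_mem_nhds p hr2), ?_⟩
  -- If `f a = a`, then `f p` is within `r / 2` of `a`, which is within `r / 2` of `p`. The inverse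
  -- also fixes `a`.
  have key : ∀ f ∈ holAut D, ∀ a ∈ {x : D | ∀ g : holAut D, dist (g.1 p) (g.1 x) < r / 2} ∩
      ball p (r / 2), f a = a → f p ∈ L := by
    rintro f hf a ⟨ha1, ha2⟩ hfa
    refine hrL ?_
    have h := ha1 ⟨f, hf⟩
    simp only [hfa] at h
    rw [mem_ball] at ha2 ⊢
    linarith [dist_triangle (f p) a p]
  intro f hf a ha hfa
  have hfa' : f⁻¹ a = a := f.symm_apply_eq.2 hfa.symm
  exact ⟨hf, key f hf a ha hfa, key f⁻¹ (inv_mem hf) a ha hfa'⟩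

section Measure

variable {a : D} [IsTopologicalGroup (isotropy D a)] [CompactSpace (isotropy D a)]
  (μ : Measure (isotropy D a)) [μ.IsHaarMeasure] [IsProbabilityMeasure μ]

/-- Otherwise a curve of fixed points tends to `a` without meeting it for `t ≠ 0`, and violates both
alternatives for small `t`. -/
theorem mem_cartanZeroSet_of_mem_isolatedFixedPairs (hD : IsOpen D) (hDb : Bornology.IsBounded D)
    {K : Set (D ≃ₜ D)} (hK : K ⊆ holAut D) {c : ℝ} {b : D}
    (h : (a, b) ∈ isolatedFixedPairs K c) : (b : Fin n → ℂ) ∈ cartanZeroSet a μ := by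
  obtain ⟨f, hf, hfa, hfb, hz⟩ := h
  refine ⟨b.2, ?_⟩
  by_contra hv
  obtain ⟨ε, hε, g, hg0, hg⟩ := exists_curve_of_fderiv_apply_eq μ hD hDb ⟨f, hK hf, hfa⟩
    (fderiv_apply_cartanMap μ hD ⟨f, hK hf, hfa⟩ hfb)
  have hgc : Tendsto (fun t => c * dist (g t) a) (𝓝[≠] 0) (𝓝 0) := by
    have h0 : ContinuousAt g 0 := (hg 0 (mem_ball_self hε)).1.continuousAt
    have : ContinuousAt (fun t => c * dist (g t) a) 0 :=
      continuousAt_const.mul (h0.dist continuousAt_const)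
    simpa [hg0] using this.tendsto.mono_left (nhdsWithin_le_nhds (s := {0}ᶜ))
  obtain ⟨t, ht1, ht2, ht0⟩ := ((hgc.eventually_lt_const one_pos).and
    ((eventually_nhdsWithin_of_eventually_nhds (ball_mem_nhds (0 : ℂ) hε)).and
      self_mem_nhdsWithin)).exists
  obtain ⟨-, htD, htφ, htf⟩ := hg t ht2
  have hfix : f ⟨g t, htD⟩ = ⟨g t, htD⟩ := Subtype.ext (by rw [← toMap_coe]; exact htf)
  rcases hz ⟨g t, htD⟩ with h1 | h1
  · exact absurd h1 (not_le.2 ht1)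
  · rw [hfix, dist_self, mul_zero] at h1
    have h2 : g t = a := congrArg Subtype.val (dist_le_zero.1 h1)
    rw [h2, cartanMap_self] at htφ
    exact (smul_ne_zero ht0 hv) htφ.symm

/-- An eigenvector would give a curve of fixed points avoiding `a` for `t ≠ 0`, hence constantly `b`
there; but the Cartan map takes the distinct values `t • v` along it. -/
theorem eq_zero_of_fderiv_apply_eq_of_fixSet_eq (hD : IsOpen D) (hDb : Bornology.IsBounded D)
    (f : isotropy D a) {b : Fin n → ℂ} (hf : fixSet f.1 = {(a : Fin n → ℂ), b}) {v : Fin n → ℂ}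
    (hv : fderiv ℂ (toMap f.1) a v = v) : v = 0 := by
  by_contra hv0
  obtain ⟨μ, _, _⟩ := exists_isHaarMeasure_isProbabilityMeasure (G := isotropy D a)
  obtain ⟨ε, hε, g, hg0, hg⟩ := exists_curve_of_fderiv_apply_eq μ hD hDb f hv
  have hgb : ∀ t ∈ ball (0 : ℂ) ε, t ≠ 0 → t • v = cartanMap a μ b := by
    intro t ht ht0
    obtain ⟨-, htD, htφ, htf⟩ := hg t ht
    have hmem : g t ∈ fixSet f.1 := ⟨htD, htf⟩
    rw [hf] at hmem
    rcases hmem with h | h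
    · rw [h, cartanMap_self] at htφ
      exact absurd htφ.symm (smul_ne_zero ht0 hv0)
    · rw [← htφ, h]
  have hmem : ∀ s : ℝ, 0 < s → s < ε → (s : ℂ) ∈ ball (0 : ℂ) ε := fun s h0 hs => by
    simpa [abs_of_pos h0] using hs
  have h2 := hgb _ (hmem (ε / 2) (by positivity) (by linarith)) (by simp [hε.ne'])
  have h3 := hgb _ (hmem (ε / 3) (by positivity) (by linarith)) (by simp [hε.ne'])
  have h4 := smul_left_injective ℂ hv0 (h2.trans h3.symm)
  have h5 : ε / 2 = ε / 3 := by exact_mod_cast h4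
  linarith

/-- Since `1` is not an eigenvalue of `f'(a)`, the map `f - id` has injective derivative at `a`, so
near `a` the displacement controls the distance to `a` linearly. -/
theorem exists_mem_isolatedFixedPairs (hD : IsOpen D) (hDb : Bornology.IsBounded D)
    {K : Set (D ≃ₜ D)} (f : isotropy D a) (hfK : f.1 ∈ K) {b : D}
    (hf : fixSet f.1 = {(a : Fin n → ℂ), (b : Fin n → ℂ)}) :
    ∃ k : ℕ, (a, b) ∈ isolatedFixedPairs K k := by
  set A : (Fin n → ℂ) →L[ℂ] (Fin n → ℂ) := fderiv ℂ (toMap f.1) a - ContinuousLinearMap.id ℂ _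
  obtain ⟨C, hC, hA⟩ := LinearMap.exists_antilipschitzWith
    (A : (Fin n → ℂ) →ₗ[ℂ] (Fin n → ℂ)) (LinearMap.ker_eq_bot'.2 fun v hv =>
      eq_zero_of_fderiv_apply_eq_of_fixSet_eq hD hDb f hf (sub_eq_zero.1 hv))
  have hder : HasFDerivAt (fun z => toMap f.1 z - z) A (a : Fin n → ℂ) :=
    (differentiableAt_toMap hD f.2.1 a.2).hasFDerivAt.sub (hasFDerivAt_id _)
  have hC' : (0 : ℝ) < C := hC
  -- With the lower bound `‖v‖ ≤ C * ‖A v‖`, an error of `1 / (2 * C)` costs half of `‖z - a‖`,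
  -- whence the constant `2 * C`.
  have hev := (Asymptotics.isLittleO_iff.1 hder.isLittleO)
    (show (0 : ℝ) < 1 / (2 * C) by positivity)
  obtain ⟨r, hr, hball⟩ := Metric.eventually_nhds_iff_ball.1 hev
  obtain ⟨k, hk⟩ := exists_nat_ge (max (1 / r) (2 * C))
  have hb : (b : Fin n → ℂ) ∈ fixSet f.1 := hf ▸ Or.inr rfl
  refine ⟨k, f.1, hfK, f.2.2, Subtype.ext (by rw [← toMap_coe]; exact hb.2), fun z => ?_⟩
  rcases le_or_gt r (dist z a) with hz | hz
  · left
    calc (1 : ℝ) = 1 / r * r := by field_simp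
      _ ≤ k * dist z a := mul_le_mul ((le_max_left _ _).trans hk) hz hr.le (by positivity)
  · right
    have h1 := hball z (by simpa [Subtype.dist_eq] using hz)
    have h2 := hA.le_mul_dist ((z : Fin n → ℂ) - a) 0
    simp only [map_zero, dist_zero_right, ContinuousLinearMap.coe_coe] at h2
    rw [toMap_apply_self, sub_self, sub_zero, toMap_coe] at h1
    have h3 : ‖A (z - a)‖ ≤ ‖(f.1 z : Fin n → ℂ) - z‖ + 1 / (2 * C) * ‖(z : Fin n → ℂ) - a‖ := by
      have := norm_sub_le ((f.1 z : Fin n → ℂ) - z) ((f.1 z : Fin n → ℂ) - z - A (z - a))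
      rw [sub_sub_cancel] at this
      linarith
    have h4 : ‖(z : Fin n → ℂ) - a‖ ≤ 2 * C * ‖(f.1 z : Fin n → ℂ) - z‖ := by
      have h5 := h2.trans (mul_le_mul_of_nonneg_left h3 hC'.le)
      have h6 : (C : ℝ) * (1 / (2 * C) * ‖(z : Fin n → ℂ) - a‖) = ‖(z : Fin n → ℂ) - a‖ / 2 := by
        field_simp
      rw [mul_add, h6] at h5
      linarith
    rw [Subtype.dist_eq, Subtype.dist_eq, dist_eq_norm, dist_eq_norm]
    exact h4.trans (mul_le_mul_of_nonneg_right ((le_max_right _ _).trans hk) (norm_nonneg _))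

end Measure

/-- Almost no pair of points of a bounded domain is the fixed point set of an automorphism. -/
theorem exists_subset_nonFixedPairs (hn : 1 ≤ n) (hD : IsOpen D) (hDc : IsConnected D)
    (hDb : Bornology.IsBounded D) :
    ∃ M ⊆ nonFixedPairs D, MeasurableSet M ∧ volume ((D ×ˢ D) \ M) = 0 := by
  choose K hKc hKD V hV hVK using exists_isCompact_of_fixed_point hD hDc hDb
  obtain ⟨s, hs, hsV⟩ := TopologicalSpace.countable_cover_nhds hV
  -- The set of bad pairs is not itself shown to be measurable; this countable union of closed sets
  -- contains it.
  set T : Set (D × D) := ⋃ p ∈ s, ⋃ k : ℕ, isolatedFixedPairs (K p) k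
  set T' : Set ((Fin n → ℂ) × (Fin n → ℂ)) := Prod.map Subtype.val Subtype.val '' T
  have hT : MeasurableSet T := MeasurableSet.biUnion hs fun p _ => MeasurableSet.iUnion fun k =>
    (isClosed_isolatedFixedPairs hD (hKc p) k).measurableSet
  have hT' : MeasurableSet T' := by
    have he := hD.isOpenEmbedding_subtypeVal.prodMap hD.isOpenEmbedding_subtypeVal
    exact (he.isEmbedding.measurableEmbedding
      he.isOpen_range.measurableSet).measurableSet_image.2 hT
  have hT'D : T' ⊆ D ×ˢ D := by
    rintro _ ⟨q, -, rfl⟩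
    exact ⟨q.1.2, q.2.2⟩
  have hgroup : ∀ a : D, ∃ _ : IsTopologicalGroup (isotropy D a),
      ∃ _ : CompactSpace (isotropy D a), ∃ μ : Measure (isotropy D a),
        μ.IsHaarMeasure ∧ IsProbabilityMeasure μ := fun a => by
    have h1 := isTopologicalGroup_isotropy a hD hDc hDb
    have h2 := compactSpace_isotropy a hD hDc hDb
    exact ⟨h1, h2, exists_isHaarMeasure_isProbabilityMeasure⟩
  refine ⟨(D ×ˢ D) \ T', ?_, (hD.prod hD).measurableSet.diff hT', ?_⟩
  · rintro ⟨a, b⟩ ⟨⟨ha, hb⟩, hab⟩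
    refine ⟨⟨ha, hb⟩, ?_⟩
    rintro ⟨f, hf, hfix⟩
    have hafix : a ∈ fixSet f := hfix ▸ Or.inl rfl
    have hfa : f ⟨a, ha⟩ = ⟨a, ha⟩ := Subtype.ext (by rw [← toMap_coe]; exact hafix.2)
    obtain ⟨_, _, -⟩ := hgroup ⟨a, ha⟩
    obtain ⟨p, hp, hap⟩ := mem_iUnion₂.1 (hsV.ge (mem_univ (⟨a, ha⟩ : D)))
    obtain ⟨k, hk⟩ := exists_mem_isolatedFixedPairs (b := ⟨b, hb⟩) hD hDb ⟨f, hf, hfa⟩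
      (hVK p f hf _ hap hfa) hfix
    exact hab ⟨(⟨a, ha⟩, ⟨b, hb⟩), mem_iUnion₂.2 ⟨p, hp, mem_iUnion.2 ⟨k, hk⟩⟩, rfl⟩
  · rw [Set.sdiff_sdiff_right_self, inter_eq_self_of_subset_right hT'D,
      Measure.volume_eq_prod, Measure.measure_prod_null hT']
    -- The slice over every `a ∈ D`, not merely almost every one, lies in the null zero set of the
    -- Cartan map at `a`.
    refine Eventually.of_forall fun a => ?_
    by_cases ha : a ∈ D
    · obtain ⟨_, _, μ, _, _⟩ := hgroup ⟨a, ha⟩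
      refine measure_mono_null ?_ (volume_cartanZeroSet μ hn hD hDc hDb)
      rintro b ⟨⟨a', b'⟩, hq, hqe⟩
      obtain ⟨rfl, rfl⟩ := Prod.ext_iff.1 hqe
      obtain ⟨p, -, hq⟩ := mem_iUnion₂.1 hq
      obtain ⟨k, hk⟩ := mem_iUnion.1 hq
      exact mem_cartanZeroSet_of_mem_isolatedFixedPairs μ hD hDb (hKD p) hk
    · refine measure_mono_null (fun b hb => (ha (hT'D hb).1).elim) measure_empty

end FixedPairs

end CartanFix

end

theorem theorem3p1 (n : ℕ) (hn : 1 ≤ n) (D : Set (Fin n → ℂ)) (hDo : IsOpen D)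
    (hDc : IsConnected D) (hDb : Bornology.IsBounded D) :
    -- the pairs that are not fixed point sets contain a set of full measure in `D²`
    (∃ M ⊆ CartanFix.nonFixedPairs D, MeasurableSet M ∧
      MeasureTheory.volume ((D ×ˢ D) \ M) = 0) ∧
    ∀ a : D,
      -- the isotropy group is a compact group, so that it has a normalized Haar measure
      IsTopologicalGroup (CartanFix.isotropy D a) ∧
      CompactSpace (CartanFix.isotropy D a) ∧
      (∃ μ : MeasureTheory.Measure (CartanFix.isotropy D a),
        μ.IsHaarMeasure ∧ MeasureTheory.IsProbabilityMeasure μ) ∧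
      ∀ μ : MeasureTheory.Measure (CartanFix.isotropy D a),
        μ.IsHaarMeasure → MeasureTheory.IsProbabilityMeasure μ →
        -- averaging over it gives a well-defined holomorphic map that linearizes it
        (∀ ζ ∈ D, MeasureTheory.Integrable (CartanFix.cartanIntegrand a ζ) μ) ∧
        DifferentiableOn ℂ (CartanFix.cartanMap a μ) D ∧
        CartanFix.cartanMap a μ a = 0 ∧
        HasFDerivAt (CartanFix.cartanMap a μ)
          (ContinuousLinearMap.id ℂ (Fin n → ℂ)) (a : Fin n → ℂ) ∧
        (∀ f ∈ CartanFix.isotropy D a, ∀ ζ ∈ D,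
          CartanFix.cartanMap a μ (CartanFix.toMap f ζ) =
            fderiv ℂ (CartanFix.toMap f) a (CartanFix.cartanMap a μ ζ)) ∧
        -- the zero set of this map is the exceptional analytic set
        CartanFix.IsAnalyticSubset D (CartanFix.cartanZeroSet a μ) ∧
        CartanFix.cartanZeroSet a μ ≠ D ∧
        CartanFix.complexDim (CartanFix.cartanZeroSet a μ) < n ∧
        ∀ b : D, (b : Fin n → ℂ) ∉ CartanFix.cartanZeroSet a μ →
          ∀ f ∈ CartanFix.holAut D, f a = a → f b = b →
            1 ≤ CartanFix.complexDim (CartanFix.fixSet f) := by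
  refine ⟨CartanFix.exists_subset_nonFixedPairs hn hDo hDc hDb, fun a => ?_⟩
  have htop := CartanFix.isTopologicalGroup_isotropy a hDo hDc hDb
  have hcomp := CartanFix.compactSpace_isotropy a hDo hDc hDb
  refine ⟨htop, hcomp, CartanFix.exists_isHaarMeasure_isProbabilityMeasure, fun μ hμ hμ' => ?_⟩
  refine ⟨fun ζ hζ => CartanFix.integrable_cartanIntegrand μ hDo hζ,
    CartanFix.differentiableOn_cartanMap μ hDo hDb, CartanFix.cartanMap_self μ,
    CartanFix.hasFDerivAt_cartanMap_self μ hDo hDb,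
    fun f hf ζ hζ => CartanFix.cartanMap_toMap μ hDo ⟨f, hf⟩ hζ,
    CartanFix.isAnalyticSubset_cartanZeroSet μ hDo hDb,
    CartanFix.cartanZeroSet_ne μ hn hDo hDc hDb,
    CartanFix.complexDim_lt_of_interior_eq_empty hn
      (CartanFix.interior_cartanZeroSet μ hn hDo hDc hDb),
    fun b hb f hf hfa hfb =>
      CartanFix.one_le_complexDim_fixSet μ hDo hDb ⟨f, hf, hfa⟩ hfb hb⟩
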